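/- **Setting.** Let $\Sigma\subset\mathbb R^n\times\mathbb R^d$ be a lattice (discrete cocompact subgroup) whose projection to $\mathbb R^d$ is injective on $\Sigma$, with image $\Gamma$, and whose projection to $\mathbb R^n$ has dense image $\Gamma^*$; let $\gamma\mapsto\gamma^*$ be the map $\Gamma\to\Gamma^*$ with graph $\Sigma$. Let $W\subset\mathbb R^n$ be an $n$-dimensional compact convex polytope, $M=-W$, and for $A\subset\mathbb R^n$ put $\mathfrak P(A)=\{\gamma\in\Gamma:\gamma^*\in A\}$. A nonsingular model set is a set $\mathfrak P(w+\mathring W)-t=\mathfrak P(w+W)-t$ for which this equality holds ($w\in\mathbb R^n$, $t\in\mathbb R^d$); $NS=(\Gamma^*-\partial W)^c$ is the set of vectors $w$ for which it holds. The language of $\Lambda\subset\mathbb R^d$ is $\{(\Lambda-\gamma)\cap B(0,R):\gamma\in\Lambda,\ R>0\}$, and the internal system $\Xi^\Gamma$ is the set of all $\Lambda\subset\Gamma$ having the common language of the nonsingular model sets, with the topology whose basic neighbourhoods of $\Lambda$ are $\{\Lambda':\Lambda'\cap K=\Lambda\cap K\}$, $K\subset\mathbb R^d$ compact. The group $\Gamma$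 acts on $\Xi^\Gamma$ by $\Lambda\mapsto\Lambda+\gamma$. The Ellis semigroup $E(\Xi^\Gamma,\Gamma)$ is the pointwise closure of this action in the space of self-maps of $\Xi^\Gamma$, with the topology of pointwise convergence and the composition product $(gh)(\Lambda)=g(h(\Lambda))$. For each $(n-1)$-dimensional face $f$ of $M$ let $A_f$ be its affine hull and $H_f$ the parallel linear hyperplane; let $\mathfrak H_W$ be the finite set of all $H_f$. For each $H\in\mathfrak H_W$ fix one of the two labellings of its open sides as $H^-,H^+$, put $H^0=H$, and let $A_f^\pm$ be the translates of $H_f^\pm$ bounded by $A_f$. Assume that $W$ is almost canonical: 1. for each $f$, $(\Gamma^*\cap H_f)+f\supseteq A_f$; 2. for each $f$, each sign and each $\gamma\in\Gamma$, the closure in $\Xi^\Gamma$ of $\{\mathfrak P(w+W): w\in(\gamma^*+A_f^\pm)\cap NS\}$ is open and closed. **The maps.** For $\Lambda\in\Xi^\Gamma$ there is a unique $w_\Lambda\in\mathbb R^n$ with $\mathfrak P(w_\Lambda+\mathring W)\subseteq\Lambda\subseteq\mathfrak P(w_\Lambda+W)$. For $g\in E(\Xi^\Gamma,\Gamma)$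 there is a unique $w_g\in\mathbb R^n$ with $w_{g(\Lambda)}=w_\Lambda+w_g$ for all $\Lambda$. For $H\in\mathfrak H_W$ there is a unique sign $\mathfrak t_g(H)\in\{-,0,+\}$ such that $g\in[H^{\mathfrak t_g(H)}+w_g]_E$, where $[A]_E$ is the closure in $E(\Xi^\Gamma,\Gamma)$ of the set of translations by the $\gamma\in\Gamma$ with $\gamma^*\in A$. **The target.** The face semigroup $\mathfrak T_W$ is the set of maps $\mathfrak t:\mathfrak H_W\to\{-,0,+\}$ whose cone $C_{\mathfrak t}=\bigcap_H H^{\mathfrak t(H)}$ is nonempty ($C_{\mathfrak t}=\mathbb R^n$ if $\mathfrak H_W=\emptyset$), with product $(\mathfrak t\mathfrak t')(H)=\mathfrak t(H)$ if $\mathfrak t(H)\ne0$ and $\mathfrak t'(H)$ otherwise; $\mathfrak T_{W,\Gamma}$ is the subsemigroup of those $\mathfrak t$ with $0\in\overline{C_{\mathfrak t}\cap\Gamma^*}$. There is a decomposition $\langle C_{\mathfrak t}\rangle=V_{\mathfrak t}\oplus D$ of the linear span such that $V_{\mathfrak t}\cap\Gamma^*$ is dense in $V_{\mathfrak t}$,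 $D\cap\Gamma^*$ is uniformly discrete and $\langle C_{\mathfrak t}\rangle\cap\Gamma^*=(V_{\mathfrak t}\cap\Gamma^*)\oplus(D\cap\Gamma^*)$; the summand $V_{\mathfrak t}$ is the same for all such decompositions. Put $\mathsf C_{\mathfrak t}=C_{\mathfrak t}\cap V_{\mathfrak t}$ and $\mathsf C_{\mathfrak t}(w,\varepsilon)=(\mathsf C_{\mathfrak t}\cap B(0,\varepsilon))+w$. **Theorem.** The maps $\Lambda\mapsto w_\Lambda$, $g\mapsto w_g$ and $g\mapsto\mathfrak t_g$ are well defined as above, and $g\mapsto(w_g,\mathfrak t_g)$ is a semigroup isomorphism of $E(\Xi^\Gamma,\Gamma)$ onto $$\bigsqcup_{\mathfrak t\in\mathfrak T_{W,\Gamma}}\bigl(\langle\mathsf C_{\mathfrak t}\rangle+\Gamma^*\bigr)\times\{\mathfrak t\},$$ which is a subsemigroup of the direct product $\mathbb R^n\times\mathfrak T_{W,\Gamma}$. There is a topology on this union in which a net satisfies $(w_\lambda,\mathfrak t_\lambda)\to(w,\mathfrak t)$ if and only if $$\forall\varepsilon>0\ \ \exists\,(\delta_\lambda),\ \delta_\lambda>0:\quad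 \mathsf C_{\mathfrak t_\lambda}(w_\lambda,\delta_\lambda)\subset\mathsf C_{\mathfrak t}(w,\varepsilon)\ \text{ for all large enough }\lambda,$$ and for this topology the isomorphism is a homeomorphism. Moreover the topology of $E(\Xi^\Gamma,\Gamma)$ is first countable. -/

import Mathlib

open Set Filter Topology
open scoped Pointwise

noncomputable section

namespace ModelSet

abbrev Eu (n : ℕ) := EuclideanSpace ℝ (Fin n)

/-- A real cut and project scheme: a lattice in internal space times physical space. -/
structure CutProject (n d : ℕ) where
  lattice : AddSubgroup (Eu n × Eu d)
  discrete : DiscreteTopology lattice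
  cocompact : CompactSpace ((Eu n × Eu d) ⧸ lattice)
  inj : Set.InjOn Prod.snd (lattice : Set (Eu n × Eu d))
  dense : Dense (Prod.fst '' (lattice : Set (Eu n × Eu d)))

namespace CutProject

variable {n d : ℕ} (S : CutProject n d)

/-- The group `Γ` in physical space. -/
def Gam : AddSubgroup (Eu d) := S.lattice.map (AddMonoidHom.snd (Eu n) (Eu d))

/-- The group `Γ*` in internal space. -/
def GamStar : AddSubgroup (Eu n) := S.lattice.map (AddMonoidHom.fst (Eu n) (Eu d))

theorem exists_star (γ : S.Gam) : ∃ x : Eu n, (x, (γ : Eu d)) ∈ S.lattice := by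
  obtain ⟨y, hy⟩ := γ
  obtain ⟨⟨a, b⟩, hp, rfl⟩ := hy
  exact ⟨a, hp⟩

/-- The star map `γ ↦ γ*`, whose graph is the lattice. -/
def star (γ : S.Gam) : Eu n := Classical.choose (S.exists_star γ)

theorem star_spec (γ : S.Gam) : (S.star γ, (γ : Eu d)) ∈ S.lattice :=
  Classical.choose_spec (S.exists_star γ)

/-- The pattern `𝔓(A) = {γ ∈ Γ | γ* ∈ A}`. -/
def pattern (A : Set (Eu n)) : Set (Eu d) := {y | ∃ h : y ∈ S.Gam, S.star ⟨y, h⟩ ∈ A}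

end CutProject

/-- An `n`-dimensional compact convex polytope in `ℝⁿ`. -/
structure Window (n : ℕ) where
  carrier : Set (Eu n)
  polytope : ∃ F : Set (Eu n), F.Finite ∧ carrier = convexHull ℝ F
  interior_nonempty : (interior carrier).Nonempty

/-- The `(n-1)`-dimensional faces of a polytope in `ℝⁿ` (there is none if `n = 0`). -/
def IsFacet {n : ℕ} (M f : Set (Eu n)) : Prop :=
  IsExposed ℝ M f ∧ f.Nonempty ∧ Module.finrank ℝ (vectorSpan ℝ f) + 1 = n

namespace Window

variable {n : ℕ} (W : Window n)

/-- The reversed window `M = -W`. -/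
def rev : Set (Eu n) := -W.carrier

/-- The family of linear hyperplanes parallel to the facets. -/
def hyperplanes : Set (Submodule ℝ (Eu n)) := {H | ∃ f, IsFacet W.rev f ∧ H = vectorSpan ℝ f}

theorem rev_polytope : ∃ F : Set (Eu n), F.Finite ∧ W.rev = convexHull ℝ F := by
  obtain ⟨F, hF, h⟩ := W.polytope
  refine ⟨-F, hF.neg, ?_⟩
  rw [rev, h, convexHull_neg]

theorem finite_hyperplanes : Finite W.hyperplanes := by
  obtain ⟨F, hF, h⟩ := W.rev_polytope
  have hc : IsCompact W.rev := by rw [h]; exact hF.isCompact_convexHull ℝ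
  have hconv : Convex ℝ W.rev := by rw [h]; exact convex_convexHull ℝ F
  have hsub : W.hyperplanes ⊆
      (fun G : Set (Eu n) => vectorSpan ℝ (closure (convexHull ℝ G))) '' {G | G ⊆ F} := by
    rintro H ⟨f, ⟨hf, -, -⟩, rfl⟩
    refine ⟨extremePoints ℝ f, ?_, ?_⟩
    · have h1 := hf.isExtreme.extremePoints_subset_extremePoints
      have h2 : extremePoints ℝ W.rev ⊆ F := by rw [h]; exact extremePoints_convexHull_subset
      exact h1.trans h2
    · have : closure (convexHull ℝ (extremePoints ℝ f)) = f :=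
        closure_convexHull_extremePoints (hf.isCompact hc) (hf.convex hconv)
      simp only [this]
  exact ((hF.finite_subsets.image _).subset hsub).to_subtype

/-- A choice, for each hyperplane `H` of the family, of the sides `H⁺` and `H⁻`, given by a linear
form with kernel `H`. -/
structure Sides where
  form : W.hyperplanes → (Eu n →ₗ[ℝ] ℝ)
  ker_form : ∀ H : W.hyperplanes, LinearMap.ker (form H) = (H : Submodule ℝ (Eu n))

end Window

section Hull

variable {n d : ℕ} (S : CutProject n d) (W : Window n)

/-- The nonsingular vectors: the complement of `Γ* - ∂W`. -/
def NS : Set (Eu n) := ((S.GamStar : Set (Eu n)) - frontier W.carrier)ᶜ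

/-- The language of a point pattern. -/
def language {d : ℕ} (L : Set (Eu d)) : Set (Set (Eu d)) :=
  {P | ∃ γ ∈ L, ∃ R : ℝ, 0 < R ∧ P = {x | x + γ ∈ L} ∩ Metric.ball 0 R}

/-- Nonsingular model sets: `𝔓(w + W°) - t = Λ = 𝔓(w + W) - t` for some `w`, `t`. -/
def IsNonsingular (L : Set (Eu d)) : Prop :=
  ∃ (w : Eu n) (t : Eu d), L = {x | x + t ∈ S.pattern (w +ᵥ interior W.carrier)} ∧
    L = {x | x + t ∈ S.pattern (w +ᵥ W.carrier)}

/-- The hull: the point patterns having the language of the nonsingular model sets. -/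
def hull : Set (Set (Eu d)) := {L | ∃ L₀, IsNonsingular S W L₀ ∧ language L = language L₀}

/-- The internal system `Ξ^Γ`: the elements of the hull supported on `Γ`. -/
def Internal : Type := {L : Set (Eu d) // L ∈ hull S W ∧ L ⊆ (S.Gam : Set (Eu d))}

/-- The topology with neighbourhood basis `{Λ' | Λ ∩ K = Λ' ∩ K}` at `Λ`, with `K` compact. -/
instance Internal.topology : TopologicalSpace (Internal S W) where
  IsOpen U := ∀ L ∈ U, ∃ K : Set (Eu d), IsCompact K ∧
    ∀ L' : Internal S W, L.1 ∩ K = L'.1 ∩ K → L' ∈ U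
  isOpen_univ := fun _ _ => ⟨∅, isCompact_empty, fun _ _ => mem_univ _⟩
  isOpen_inter := by
    intro U V hU hV L hL
    obtain ⟨K, hK, h⟩ := hU L hL.1
    obtain ⟨K', hK', h'⟩ := hV L hL.2
    refine ⟨K ∪ K', hK.union hK', fun L' e => ⟨h L' ?_, h' L' ?_⟩⟩
    · have := congrArg (· ∩ K) e
      simpa [inter_assoc, union_inter_cancel_left] using this
    · have := congrArg (· ∩ K') e
      simpa [inter_assoc, union_inter_cancel_right] using this
  isOpen_sUnion := by
    rintro C hC L ⟨U, hU, hL⟩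
    obtain ⟨K, hK, h⟩ := hC U hU L hL
    exact ⟨K, hK, fun L' e => ⟨U, hU, h L' e⟩⟩

theorem language_translate {d : ℕ} (L : Set (Eu d)) (c : Eu d) :
    language {x | x - c ∈ L} = language L := by
  ext P
  constructor
  · rintro ⟨γ, hγ, R, hR, rfl⟩
    refine ⟨γ - c, hγ, R, hR, ?_⟩
    ext x
    simp [add_sub_assoc]
  · rintro ⟨γ, hγ, R, hR, rfl⟩
    refine ⟨γ + c, by simpa using hγ, R, hR, ?_⟩
    ext x
    simp [add_sub_assoc]

/-- The action of `Γ` on the internal system: translation site by site, `Λ ↦ Λ + γ`. -/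
def translate (γ : S.Gam) (L : Internal S W) : Internal S W :=
  ⟨{x | x - (γ : Eu d) ∈ L.1}, by
    obtain ⟨⟨L₀, h₀, e⟩, hL⟩ := L.2
    refine ⟨⟨L₀, h₀, (language_translate _ _).trans e⟩, fun x hx => ?_⟩
    have := S.Gam.add_mem (hL hx) γ.2
    simpa using this⟩

theorem translate_add (γ γ' : S.Gam) (L : Internal S W) :
    translate S W γ (translate S W γ' L) = translate S W (γ + γ') L := by
  apply Subtype.ext
  ext x
  simp [translate, sub_sub]

theorem continuous_translate (γ : S.Gam) : Continuous (translate S W γ) := by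
  refine ⟨fun U hU L hL => ?_⟩
  obtain ⟨K, hK, h⟩ := hU _ hL
  refine ⟨(fun x => x - (γ : Eu d)) '' K, hK.image (by fun_prop), fun L' e => h _ ?_⟩
  ext x
  have := Set.ext_iff.1 e (x - (γ : Eu d))
  simp only [mem_inter_iff, mem_image, sub_left_inj, exists_eq_right] at this
  exact this

/-- The Ellis semigroup `E(Ξ^Γ, Γ)`: the pointwise closure of the action of `Γ`. -/
def Ellis : Type := {g : Internal S W → Internal S W // g ∈ closure (range (translate S W))}

instance : TopologicalSpace (Ellis S W) := instTopologicalSpaceSubtype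

theorem comp_mem_closure {g h : Internal S W → Internal S W}
    (hg : g ∈ closure (range (translate S W))) (hh : h ∈ closure (range (translate S W))) :
    g ∘ h ∈ closure (range (translate S W)) := by
  have h1 : ∀ γ, translate S W γ ∘ h ∈ closure (range (translate S W)) := by
    intro γ
    have hc : Continuous fun k : Internal S W → Internal S W => translate S W γ ∘ k :=
      continuous_pi fun L => (continuous_translate S W γ).comp (continuous_apply L)
    refine map_mem_closure hc hh ?_
    rintro _ ⟨γ', rfl⟩
    exact ⟨γ + γ', funext fun L => (translate_add S W γ γ' L).symm⟩
  have hc : Continuous fun k : Internal S W → Internal S W => k ∘ h :=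
    continuous_pi fun L => continuous_apply (h L)
  have := map_mem_closure (t := closure (range (translate S W))) hc hg (by
    rintro _ ⟨γ, rfl⟩
    exact h1 γ)
  rwa [closure_closure] at this

/-- The semigroup law is composition, `(g * h)(Λ) = g(h(Λ))`. -/
instance : Semigroup (Ellis S W) where
  mul g h := ⟨g.1 ∘ h.1, comp_mem_closure S W g.2 h.2⟩
  mul_assoc _ _ _ := rfl

/-- `[A]_Ξ`: the closure in the internal system of the nonsingular model sets `𝔓(w + W)` with
`w ∈ A`. -/
def cut (A : Set (Eu n)) : Set (Internal S W) :=
  closure {L | ∃ w ∈ A ∩ NS S W, L.1 = S.pattern (w +ᵥ W.carrier)}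

/-- `[A]_E`: the closure in the Ellis semigroup of the `γ ∈ Γ` with `γ* ∈ A`. -/
def ellisCut (A : Set (Eu n)) : Set (Ellis S W) :=
  closure {g | ∃ γ : S.Gam, S.star γ ∈ A ∧ g.1 = translate S W γ}

/-- `𝔓(w + W°) ⊆ Λ ⊆ 𝔓(w + W)`. -/
def IsParam (L : Internal S W) (w : Eu n) : Prop :=
  S.pattern (w +ᵥ interior W.carrier) ⊆ L.1 ∧ L.1 ⊆ S.pattern (w +ᵥ W.carrier)

/-- The factor map `Π`, sending `Λ` to the unique `w_Λ` with
`𝔓(w_Λ + W°) ⊆ Λ ⊆ 𝔓(w_Λ + W)`. -/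
def param (L : Internal S W) : Eu n := Classical.epsilon (IsParam S W L)

/-- The vector `w_g = Π*(g)`, with `Π(g(Λ)) = Π(Λ) + w_g` for every `Λ`. -/
def vec (g : Ellis S W) : Eu n :=
  Classical.epsilon fun v => ∀ L, param S W (g.1 L) = param S W L + v

end Hull

section Faces

variable {n d : ℕ} {W : Window n} (o : W.Sides)

/-- The translate `H^s + w`, where `H^{-1}`, `H^0`, `H^1` are `H⁻`, `H`, `H⁺`. -/
def side (H : W.hyperplanes) (s : SignType) (w : Eu n) : Set (Eu n) :=
  {x | SignType.sign (o.form H (x - w)) = s}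

/-- For a facet `f` with affine hull `A_f` parallel to `H_f`: the open half space `A_f^s` for
`s = ±1`. -/
def affSide (f : Set (Eu n)) (hf : IsFacet W.rev f) (s : SignType) : Set (Eu n) :=
  {x | ∃ p ∈ f, SignType.sign (o.form ⟨vectorSpan ℝ f, f, hf, rfl⟩ (x - p)) = s}

/-- The two assumptions making a polytopal window almost canonical. The first: for each facet `f`
of `M = -W`, the sum of `Stab_Γ(A_f)* = Γ* ∩ H_f` and `f` covers `A_f`. The second: `[A]_Ξ` is
clopen for every admissible half space `A = γ* + A_f^±`. -/
def AlmostCanonical (S : CutProject n d) (W : Window n) (o : W.Sides) : Prop :=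
  (∀ f, IsFacet W.rev f → (affineSpan ℝ f : Set (Eu n)) ⊆
    ((S.GamStar : Set (Eu n)) ∩ (vectorSpan ℝ f : Set (Eu n))) + f) ∧
  ∀ (f : Set (Eu n)) (hf : IsFacet W.rev f) (γ : S.Gam) (s : SignType), s ≠ 0 →
    IsClopen (cut S W (S.star γ +ᵥ affSide o f hf s))

/-- The set `⋂ H^{t(H)}`. -/
def coneSet (t : W.hyperplanes → SignType) : Set (Eu n) :=
  {x | ∀ H, SignType.sign (o.form H x) = t H}

/-- The face semigroup `𝔗_W`, its elements being described by their cone types: the sign maps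
whose cone is nonempty. -/
@[ext]
structure FaceType where
  sgn : W.hyperplanes → SignType
  nonempty : (coneSet o sgn).Nonempty

/-- The pointwise product of cone types. -/
def signMul (s t : W.hyperplanes → SignType) : W.hyperplanes → SignType :=
  fun H => if s H = 0 then t H else s H

theorem add_mem_coneSet {s : W.hyperplanes → SignType} {x : Eu n} (hx : x ∈ coneSet o s) :
    ∀ᶠ y in 𝓝 (0 : Eu n), ∀ t, y ∈ coneSet o t → x + y ∈ coneSet o (signMul s t) := by
  have := W.finite_hyperplanes
  have key : ∀ H : W.hyperplanes, ∀ᶠ y in 𝓝 (0 : Eu n), o.form H x ≠ 0 →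
      SignType.sign (o.form H (x + y)) = SignType.sign (o.form H x) := by
    intro H
    have hc : Continuous fun y => o.form H (x + y) :=
      (o.form H).continuous_of_finiteDimensional.comp (continuous_const.add continuous_id)
    have ht : Tendsto (fun y => o.form H (x + y)) (𝓝 0) (𝓝 (o.form H x)) := by
      simpa using hc.tendsto 0
    rcases lt_trichotomy (o.form H x) 0 with h | h | h
    · filter_upwards [ht.eventually (gt_mem_nhds h)] with y hy _
      rw [sign_neg hy, sign_neg h]
    · exact Eventually.of_forall fun y hy => absurd h hy
    · filter_upwards [ht.eventually (lt_mem_nhds h)] with y hy _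
      rw [sign_pos hy, sign_pos h]
  filter_upwards [eventually_all.2 key] with y hy t hyt H
  unfold signMul
  by_cases h : o.form H x = 0
  · have hs : s H = 0 := by rw [← hx H, h, sign_zero]
    rw [if_pos hs, map_add, h, zero_add, hyt H]
  · have hs : s H ≠ 0 := by rw [← hx H]; exact fun e => h (sign_eq_zero_iff.1 e)
    rw [if_neg hs, hy H h, hx H]

theorem smul_mem_coneSet {t : W.hyperplanes → SignType} {y : Eu n} (hy : y ∈ coneSet o t)
    {c : ℝ} (hc : 0 < c) : c • y ∈ coneSet o t := by
  intro H
  rw [map_smul, smul_eq_mul, sign_mul, sign_pos hc, one_mul, hy H]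

theorem signMul_nonempty {s t : W.hyperplanes → SignType} (hs : (coneSet o s).Nonempty)
    (ht : (coneSet o t).Nonempty) : (coneSet o (signMul s t)).Nonempty := by
  obtain ⟨x, hx⟩ := hs
  obtain ⟨y, hy⟩ := ht
  have hl : Tendsto (fun c : ℝ => c • y) (𝓝[>] 0) (𝓝 0) := by
    have : Continuous fun c : ℝ => c • y := by fun_prop
    simpa using (this.tendsto 0).mono_left nhdsWithin_le_nhds
  obtain ⟨c, hc, hc0⟩ := ((hl.eventually (add_mem_coneSet o hx)).and self_mem_nhdsWithin).exists
  exact ⟨x + c • y, hc t (smul_mem_coneSet o hy hc0)⟩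

instance : Semigroup (FaceType o) where
  mul s t := ⟨signMul s.sgn t.sgn, signMul_nonempty o s.nonempty t.nonempty⟩
  mul_assoc a b c := by
    apply FaceType.ext
    funext H
    change signMul (signMul a.sgn b.sgn) c.sgn H = signMul a.sgn (signMul b.sgn c.sgn) H
    unfold signMul
    by_cases h : a.sgn H = 0 <;> simp [h]

/-- The cone `C_t` of a cone type. -/
def FaceType.cone {o : W.Sides} (t : FaceType o) : Set (Eu n) := coneSet o t.sgn

/-- The nontrivial face semigroup `𝔗_{W,Γ}`: the origin is an accumulation point of elements of
`C_t ∩ Γ*` (these come arbitrarily close to the origin, and may be the origin itself). -/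
def nontrivialFaces (S : CutProject n d) (o : W.Sides) : Subsemigroup (FaceType o) where
  carrier := {t | (0 : Eu n) ∈ closure (t.cone ∩ (S.GamStar : Set (Eu n)))}
  mul_mem' := by
    intro s t hs ht
    rw [mem_ofPred_eq, Metric.mem_closure_iff] at hs ht ⊢
    intro ε hε
    obtain ⟨x, ⟨hx, hxG⟩, hxε⟩ := hs (ε / 2) (half_pos hε)
    obtain ⟨r, hr, hball⟩ := Metric.eventually_nhds_iff.1 (add_mem_coneSet o hx)
    obtain ⟨y, ⟨hy, hyG⟩, hyε⟩ := ht (min r (ε / 2)) (lt_min hr (half_pos hε))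
    refine ⟨x + y, ⟨hball ?_ _ hy, S.GamStar.add_mem hxG hyG⟩, ?_⟩
    · rw [dist_comm]; exact hyε.trans_le (min_le_left _ _)
    · have h2 := hyε.trans_le (min_le_right _ _)
      rw [dist_zero_left] at *
      linarith [norm_add_le x y]

/-- The decompositions `⟨C⟩ = V ⊕ D` with `V ∩ Γ*` dense in `V`, `D ∩ Γ*` uniformly discrete and
`⟨C⟩ ∩ Γ* = (V ∩ Γ*) ⊕ (D ∩ Γ*)`. -/
def IsDecomposition (S : CutProject n d) (C : Set (Eu n)) (V D : Submodule ℝ (Eu n)) : Prop :=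
  V ⊔ D = Submodule.span ℝ C ∧ V ⊓ D = ⊥ ∧
  (V : Set (Eu n)) ⊆ closure ((V : Set (Eu n)) ∩ S.GamStar) ∧
  (∃ r : ℝ, 0 < r ∧ ∀ x ∈ D, x ∈ S.GamStar → ∀ y ∈ D, y ∈ S.GamStar → x ≠ y → r ≤ dist x y) ∧
  (Submodule.span ℝ C).toAddSubgroup ⊓ S.GamStar =
    (V.toAddSubgroup ⊓ S.GamStar) ⊔ (D.toAddSubgroup ⊓ S.GamStar)

/-- The summand `V` of such a decomposition. (It exists and does not depend on the decomposition,
so that the supremum is over a single subspace.) -/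
def denseSummand (S : CutProject n d) (C : Set (Eu n)) : Submodule ℝ (Eu n) :=
  sSup {V | ∃ D, IsDecomposition S C V D}

/-- The plain cone `C_t ∩ V` of a cone type. -/
def plainCone (S : CutProject n d) {o : W.Sides} (t : FaceType o) : Set (Eu n) :=
  t.cone ∩ (denseSummand S t.cone : Set (Eu n))

/-- The head `(C_t ∩ V ∩ B(0, ε)) + w` of the plain cone, translated at `w`. -/
def plainHead (S : CutProject n d) {o : W.Sides} (t : FaceType o) (w : Eu n) (ε : ℝ) :
    Set (Eu n) :=
  w +ᵥ (plainCone S t ∩ Metric.ball 0 ε)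

/-- The cone type `t_g`: the sign `t_g(H)` is the one for which `g ∈ [H^{t_g(H)} + w_g]_E`. -/
def coneType (S : CutProject n d) (o : W.Sides) (g : Ellis S W) : W.hyperplanes → SignType :=
  fun H => Classical.epsilon fun s => g ∈ ellisCut S W (side o H s (vec S W g))

/-- The union over `t ∈ 𝔗_{W,Γ}` of `(⟨plain cone of t⟩ + Γ*) × {t}`. -/
def imageSet (S : CutProject n d) (o : W.Sides) :
    Set (Multiplicative (Eu n) × nontrivialFaces S o) :=
  {p | p.1.toAdd ∈ (Submodule.span ℝ (plainCone S p.2.1) : Set (Eu n)) + (S.GamStar : Set (Eu n))}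

/-- The convergence class on pairs (vector, cone type), for families indexed by a set with a
filter (for a net, the filter of tails of the index set). -/
def ConeConverges (S : CutProject n d) (o : W.Sides) {ι : Type*} (l : Filter ι)
    (p : ι → Multiplicative (Eu n) × nontrivialFaces S o)
    (q : Multiplicative (Eu n) × nontrivialFaces S o) : Prop :=
  ∀ ε : ℝ, 0 < ε → ∃ δ : ι → ℝ, (∀ i, 0 < δ i) ∧
    ∀ᶠ i in l, plainHead S (p i).2.1 (p i).1.toAdd (δ i) ⊆ plainHead S q.2.1 q.1.toAdd ε

end Faces

end ModelSet

end

open ModelSet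

/-! A pattern `Λ` of the internal system is squeezed between an open and a closed model set with the
same parameter `w_Λ`, so only points on the boundary of the translated window are undecided. Almost
canonicity encodes these decisions by half spaces. By the first condition nonsingular vectors avoid
every hyperplane `γ* + A_f`; by the second, the bit telling whether `Λ` lies on the positive side of
`γ* + A_f` is clopen, so that its properties extend from the nonsingular model sets to all patterns
by density. The bits determine `Λ` and its topology (`Internal.ext_above`,
`Internal.tendsto_iff_above`), and only those at hyperplanes through `w_Λ` are not forced by `w_Λ`.

An element `g` of the Ellis semigroup is a limit of translations along an ultrafilter on `Γ`. Along
it `γ*` tends to `w_g` and the sign of each form at `γ* - w_g` is eventually constant; these signs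
are `t_g`. Translation shifts levels, so the bit of `g(Λ)` at a hyperplane through `w_Λ + w_g` is
dictated by `t_g(H)` when this is nonzero and is otherwise copied from `Λ` at the parallel
hyperplane through `w_Λ` (`above_apply`). Applied twice, this yields the product of faces. Pairs of
patterns with opposite bits (`exists_coneType_detecting_pair`) read the sign off the action. Hence
the pair `(w_g, t_g)` determines `g`, and convergence to `g` means convergence of vectors together
with an eventual sign condition (`ellis_tendsto_iff`); first countability follows.

The image consists of the pairs for which `w` is approximated by `Γ*` inside `w + C_t`
(`admissible_ellis`, `exists_ellis`). The rest concerns subgroups of `ℝⁿ`: small elements of the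
closure of `⟨C_t⟩ ∩ Γ*` lie in its largest linear subspace `V` (`exists_pos_forall_mem_denseSpace`),
which is the dense summand of the decomposition. Approximants close to `w` thus differ from `w` by
vectors of `V`, which identifies the image (`admissible_iff`) and allows plain cones to replace
cones in the description of the topology. -/

namespace ModelSet

/-! ### The star map and finite local complexity -/

namespace CutProject

variable {n d : ℕ} (S : CutProject n d)

theorem star_eq {γ : S.Gam} {x : Eu n} (h : (x, (γ : Eu d)) ∈ S.lattice) : S.star γ = x :=
  congrArg Prod.fst (S.inj (S.star_spec γ) h rfl)

@[simp]
theorem star_add (γ γ' : S.Gam) : S.star (γ + γ') = S.star γ + S.star γ' :=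
  S.star_eq (S.lattice.add_mem (S.star_spec γ) (S.star_spec γ'))

@[simp]
theorem star_neg (γ : S.Gam) : S.star (-γ) = -S.star γ :=
  S.star_eq (S.lattice.neg_mem (S.star_spec γ))

@[simp]
theorem star_sub (γ γ' : S.Gam) : S.star (γ - γ') = S.star γ - S.star γ' :=
  S.star_eq (S.lattice.sub_mem (S.star_spec γ) (S.star_spec γ'))

theorem star_mem (γ : S.Gam) : S.star γ ∈ S.GamStar := ⟨_, S.star_spec γ, rfl⟩

theorem exists_star_eq {x : Eu n} (hx : x ∈ S.GamStar) : ∃ γ, S.star γ = x := by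
  obtain ⟨⟨a, b⟩, h, rfl⟩ := hx
  exact ⟨⟨b, ⟨_, h, rfl⟩⟩, S.star_eq h⟩

theorem dense_gamStar : Dense (S.GamStar : Set (Eu n)) := S.dense

theorem exists_star_mem {U : Set (Eu n)} (hU : IsOpen U) (hne : U.Nonempty) :
    ∃ γ, S.star γ ∈ U := by
  obtain ⟨x, hx, hxU⟩ := S.dense_gamStar.exists_mem_open hU hne
  obtain ⟨γ, rfl⟩ := S.exists_star_eq hx
  exact ⟨γ, hxU⟩

theorem mem_pattern (γ : S.Gam) (A : Set (Eu n)) :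
    (γ : Eu d) ∈ S.pattern A ↔ S.star γ ∈ A :=
  ⟨fun ⟨_, h⟩ => h, fun h => ⟨γ.2, h⟩⟩

theorem pattern_subset (A : Set (Eu n)) : S.pattern A ⊆ S.Gam := fun _ h => h.1

theorem pattern_mono {A B : Set (Eu n)} (h : A ⊆ B) : S.pattern A ⊆ S.pattern B :=
  fun _ hx => ⟨hx.1, h hx.2⟩

/-- Finite local complexity: bounded windows have locally finite patterns. -/
theorem finite_star_mem {A : Set (Eu n)} {K : Set (Eu d)} (hA : Bornology.IsBounded A)
    (hK : Bornology.IsBounded K) : {γ : S.Gam | (γ : Eu d) ∈ K ∧ S.star γ ∈ A}.Finite := by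
  have := S.discrete
  have hc : IsClosed (S.lattice : Set (Eu n × Eu d)) := AddSubgroup.isClosed_of_discrete
  have hd : DiscreteTopology (S.lattice : Set (Eu n × Eu d)) := S.discrete
  have hf := Metric.finite_isBounded_inter_isClosed hd.isDiscrete (hA.prod hK) hc
  refine Finite.of_finite_image (f := fun γ => (S.star γ, (γ : Eu d)))
    (hf.subset ?_) fun γ _ γ' _ h => Subtype.ext (congrArg Prod.snd h)
  rintro _ ⟨γ, ⟨h1, h2⟩, rfl⟩
  exact ⟨⟨h2, h1⟩, S.star_spec γ⟩

theorem finite_pattern_inter {A : Set (Eu n)} {K : Set (Eu d)} (hA : Bornology.IsBounded A)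
    (hK : Bornology.IsBounded K) : (S.pattern A ∩ K).Finite := by
  refine ((S.finite_star_mem hA hK).image (fun γ : S.Gam => (γ : Eu d))).subset ?_
  rintro x ⟨⟨h, hx⟩, hxK⟩
  exact ⟨⟨x, h⟩, ⟨hxK, hx⟩, rfl⟩

theorem countable_gamStar : (S.GamStar : Set (Eu n)).Countable := by
  have := S.discrete
  have : Countable S.lattice := TopologicalSpace.separableSpace_iff_countable.1 inferInstance
  have h : (S.lattice : Set (Eu n × Eu d)).Countable := Set.countable_coe_iff.1 this
  exact h.image Prod.fst

end CutProject

/-! ### Translates of a convex window -/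

namespace Window

variable {n : ℕ} (W : Window n)

theorem isCompact : IsCompact W.carrier := by
  obtain ⟨F, hF, h⟩ := W.polytope
  rw [h]; exact hF.isCompact_convexHull ℝ

theorem convex : Convex ℝ W.carrier := by
  obtain ⟨F, hF, h⟩ := W.polytope
  rw [h]; exact convex_convexHull ℝ F

theorem isClosed : IsClosed W.carrier := W.isCompact.isClosed

theorem subset_closure_interior : W.carrier ⊆ closure (interior W.carrier) := by
  rw [W.convex.closure_interior_eq_closure_of_nonempty_interior W.interior_nonempty]
  exact subset_closure

theorem mem_rev {x : Eu n} : x ∈ W.rev ↔ -x ∈ W.carrier := Iff.rfl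

theorem mem_vadd_interior_iff {w x : Eu n} :
    x ∈ w +ᵥ interior W.carrier ↔ x - w ∈ interior W.carrier := by
  rw [mem_vadd_set_iff_neg_vadd_mem, vadd_eq_add, neg_add_eq_sub]

theorem mem_vadd_iff_sub {w x : Eu n} : x ∈ w +ᵥ W.carrier ↔ x - w ∈ W.carrier := by
  rw [mem_vadd_set_iff_neg_vadd_mem, vadd_eq_add, neg_add_eq_sub]

/-- A translate of a window included in a translate is equal to it. -/
theorem eq_of_vadd_interior_subset {w w' : Eu n}
    (h : w +ᵥ interior W.carrier ⊆ w' +ᵥ W.carrier) : w = w' := by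
  -- The window absorbs the translation by `w - w'`; iterating it contradicts boundedness unless `w
  -- = w'`.
  have h1 : ∀ x ∈ W.carrier, x + (w - w') ∈ W.carrier := by
    intro x hx
    have hcl : IsClosed {x : Eu n | x + (w - w') ∈ W.carrier} :=
      W.isClosed.preimage (by fun_prop)
    refine (closure_minimal ?_ hcl) (W.subset_closure_interior hx)
    intro y hy
    have := h (show w + y ∈ _ from ⟨y, hy, rfl⟩)
    rw [W.mem_vadd_iff_sub] at this
    rwa [show w + y - w' = y + (w - w') by abel] at this
  obtain ⟨x, hx⟩ := W.interior_nonempty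
  have h2 : ∀ k : ℕ, x + (k : ℝ) • (w - w') ∈ W.carrier := by
    intro k
    induction k with
    | zero => simpa using interior_subset hx
    | succ k ih =>
      have := h1 _ ih
      rw [add_assoc] at this
      convert this using 2
      push_cast
      module
  by_contra hne
  obtain ⟨C, hC⟩ := W.isCompact.isBounded.exists_norm_le
  have hpos : 0 < ‖w - w'‖ := norm_pos_iff.2 (sub_ne_zero.2 hne)
  obtain ⟨k, hk⟩ := exists_nat_gt ((C + ‖x‖) / ‖w - w'‖)
  rw [div_lt_iff₀ hpos] at hk
  have h3 := hC _ (h2 k)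
  have h4 : ‖(k : ℝ) • (w - w')‖ ≤ ‖x + (k : ℝ) • (w - w')‖ + ‖x‖ := by
    simpa using norm_sub_le (x + (k : ℝ) • (w - w')) x
  rw [norm_smul, Real.norm_natCast] at h4
  linarith

end Window

/-! ### Nonsingular vectors -/

section Hull

variable {n d : ℕ} (S : CutProject n d) (W : Window n)

theorem mem_NS {w : Eu n} :
    w ∈ NS S W ↔ ∀ γ : S.Gam, S.star γ - w ∈ W.carrier → S.star γ - w ∈ interior W.carrier := by
  constructor
  · intro h γ hγ
    by_contra hi
    refine h ⟨S.star γ, S.star_mem γ, S.star γ - w, ⟨subset_closure hγ, hi⟩, ?_⟩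
    simp
  · rintro h ⟨x, hx, y, hy, rfl⟩
    obtain ⟨γ, rfl⟩ := S.exists_star_eq hx
    have h' := h γ
    simp only [sub_sub_cancel] at h'
    rw [W.isClosed.frontier_eq] at hy
    exact hy.2 (h' hy.1)

theorem add_star_mem_NS {w : Eu n} (h : w ∈ NS S W) (γ : S.Gam) : w + S.star γ ∈ NS S W := by
  rw [mem_NS] at h ⊢
  intro γ'
  simpa [sub_sub, add_comm] using h (γ' - γ)

/-- Baire: the singular vectors form a countable union of copies of the frontier of a closed set,
which is closed with empty interior. -/
theorem dense_NS : Dense (NS S W) := by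
  have : Countable (S.GamStar : Set (Eu n)) := S.countable_gamStar.to_subtype
  have hU : NS S W = ⋂ x : (S.GamStar : Set (Eu n)), {w | (x : Eu n) - w ∈ frontier W.carrier}ᶜ := by
    ext w
    simp only [NS, mem_compl_iff, mem_iInter, mem_ofPred_eq]
    constructor
    · intro h x hx
      exact h ⟨x, x.2, _, hx, by simp⟩
    · rintro h ⟨x, hx, y, hy, rfl⟩
      exact h ⟨x, hx⟩ (by simpa using hy)
  rw [hU]
  refine dense_iInter_of_isOpen (fun x => ?_) fun x => ?_
  · exact (isClosed_frontier.preimage (by fun_prop)).isOpen_compl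
  · let e := Homeomorph.subLeft (x : Eu n)
    have h1 : Dense (frontier W.carrier)ᶜ := by
      rw [← interior_eq_empty_iff_dense_compl]
      exact interior_frontier W.isClosed
    have := h1.preimage e.isOpenMap
    exact this

/-- Near a nonsingular vector, the model sets agree locally. -/
theorem eventually_mem_iff {w : Eu n} (hw : w ∈ NS S W) {K : Set (Eu d)}
    (hK : Bornology.IsBounded K) : ∀ᶠ w' in 𝓝 w, ∀ γ : S.Gam, (γ : Eu d) ∈ K →
      (S.star γ - w ∈ W.carrier → S.star γ - w' ∈ interior W.carrier) ∧
      (S.star γ - w' ∈ W.carrier → S.star γ - w ∈ W.carrier) := by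
  -- For `w'` within distance `1` of `w`, only finitely many `γ` in `K` can meet either translate,
  -- so finitely many open conditions suffice.
  have hb : Bornology.IsBounded (W.carrier + Metric.ball w 1) :=
    W.isCompact.isBounded.add Metric.isBounded_ball
  have hfin := S.finite_star_mem hb hK
  have h1 : ∀ γ ∈ {γ : S.Gam | (γ : Eu d) ∈ K ∧ S.star γ ∈ W.carrier + Metric.ball w 1},
      ∀ᶠ w' in 𝓝 w, (S.star γ - w ∈ W.carrier → S.star γ - w' ∈ interior W.carrier) ∧
      (S.star γ - w' ∈ W.carrier → S.star γ - w ∈ W.carrier) := by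
    intro γ _
    have ht : Tendsto (fun w' => S.star γ - w') (𝓝 w) (𝓝 (S.star γ - w)) :=
      Continuous.tendsto (by fun_prop) w
    by_cases h : S.star γ - w ∈ W.carrier
    · filter_upwards [ht.eventually (isOpen_interior.mem_nhds ((mem_NS S W).1 hw γ h))] with w' hw'
      exact ⟨fun _ => hw', fun _ => h⟩
    · filter_upwards [ht.eventually (W.isClosed.isOpen_compl.mem_nhds h)] with w' hw'
      exact ⟨fun h' => absurd h' h, fun h' => absurd h' hw'⟩
  filter_upwards [(eventually_all_finite hfin).2 h1, Metric.ball_mem_nhds w one_pos]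
    with w' hw' hb' γ hγ
  by_cases hA : S.star γ ∈ W.carrier + Metric.ball w 1
  · exact hw' γ ⟨hγ, hA⟩
  · refine ⟨fun h => absurd ⟨_, h, w, Metric.mem_ball_self one_pos, by simp⟩ hA,
      fun h => absurd ⟨_, h, w', hb', by simp⟩ hA⟩

end Hull
-- Patterns as local limits and their parameter
section Hull

variable {n d : ℕ} (S : CutProject n d) (W : Window n)

/-- `L` is locally equal to nonsingular model sets with parameter arbitrarily close to `w`. -/
structure IsLocalLimit (L : Set (Eu d)) (w : Eu n) : Prop where
  subset : L ⊆ S.Gam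
  approx : ∀ ε > 0, ∀ R : ℝ, ∃ w' ∈ NS S W, dist w' w < ε ∧
    ∀ γ : S.Gam, ‖(γ : Eu d)‖ < R → ((γ : Eu d) ∈ L ↔ S.star γ - w' ∈ W.carrier)

variable {S W}

theorem IsLocalLimit.mem_of_interior {L : Set (Eu d)} {w : Eu n} (h : IsLocalLimit S W L w)
    {γ : S.Gam} (hγ : S.star γ - w ∈ interior W.carrier) : (γ : Eu d) ∈ L := by
  have ht : Tendsto (fun w' => S.star γ - w') (𝓝 w) (𝓝 (S.star γ - w)) :=
    Continuous.tendsto (by fun_prop) w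
  obtain ⟨ε, hε, hb⟩ := Metric.eventually_nhds_iff.1
    (ht.eventually (isOpen_interior.mem_nhds hγ))
  obtain ⟨w', -, hd, hw'⟩ := h.approx ε hε (‖(γ : Eu d)‖ + 1)
  exact (hw' γ (by linarith)).2 (interior_subset (hb hd))

theorem IsLocalLimit.sub_mem {L : Set (Eu d)} {w : Eu n} (h : IsLocalLimit S W L w)
    {γ : S.Gam} (hγ : (γ : Eu d) ∈ L) : S.star γ - w ∈ W.carrier := by
  by_contra hc
  have ht : Tendsto (fun w' => S.star γ - w') (𝓝 w) (𝓝 (S.star γ - w)) :=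
    Continuous.tendsto (by fun_prop) w
  obtain ⟨ε, hε, hb⟩ := Metric.eventually_nhds_iff.1
    (ht.eventually (W.isClosed.isOpen_compl.mem_nhds hc))
  obtain ⟨w', -, hd, hw'⟩ := h.approx ε hε (‖(γ : Eu d)‖ + 1)
  exact hb hd ((hw' γ (by linarith)).1 hγ)

theorem mem_pattern_vadd (γ : S.Gam) (w : Eu n) :
    (γ : Eu d) ∈ S.pattern (w +ᵥ W.carrier) ↔ S.star γ - w ∈ W.carrier := by
  rw [S.mem_pattern, W.mem_vadd_iff_sub]

theorem isLocalLimit_pattern {w : Eu n} (hw : w ∈ NS S W) :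
    IsLocalLimit S W (S.pattern (w +ᵥ W.carrier)) w :=
  ⟨S.pattern_subset _, fun ε hε _ => ⟨w, hw, by simpa using hε,
    fun γ _ => mem_pattern_vadd γ w⟩⟩

theorem isNonsingular_pattern {w : Eu n} (hw : w ∈ NS S W) :
    IsNonsingular S W (S.pattern (w +ᵥ W.carrier)) := by
  refine ⟨w, 0, ?_, by simp⟩
  simp only [add_zero, ofPred_mem_eq]
  refine Set.Subset.antisymm (fun x hx => ?_) (S.pattern_mono (vadd_set_mono interior_subset))
  obtain ⟨h, hx⟩ := hx
  rw [W.mem_vadd_iff_sub] at hx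
  exact ⟨h, W.mem_vadd_interior_iff.2 ((mem_NS S W).1 hw _ hx)⟩

/-- A point pattern between `𝔓(w + W°)` and `𝔓(w + W)` contains all the local patterns of
nonsingular model sets. -/
theorem language_subset_of_isLocalLimit {L : Set (Eu d)} {w w₀ : Eu n} (h : IsLocalLimit S W L w)
    (hw₀ : w₀ ∈ NS S W) : language (S.pattern (w₀ +ᵥ W.carrier)) ⊆ language L := by
  rintro P ⟨y, ⟨hy, hyW⟩, R, hR, rfl⟩
  have hev := eventually_mem_iff S W hw₀ (Metric.isBounded_ball (x := y) (r := R))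
  obtain ⟨U, hU, hUo, hUw⟩ := eventually_nhds_iff.1 hev
  -- Density of `Γ*` brings the parameter `w + γ₀*` of a translate of `L` close enough to `w₀`.
  obtain ⟨γ₀, hγ₀⟩ := S.exists_star_mem (U := (fun x => w + x) ⁻¹' U)
    (hUo.preimage (by fun_prop)) ⟨w₀ - w, by simpa using hUw⟩
  have key : ∀ γ : S.Gam, (γ : Eu d) ∈ Metric.ball y R →
      ((γ : Eu d) ∈ S.pattern (w₀ +ᵥ W.carrier) ↔ (γ : Eu d) - γ₀ ∈ L) := by
    intro γ hγ
    obtain ⟨h1, h2⟩ := hU _ hγ₀ γ hγ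
    rw [mem_pattern_vadd]
    have e : S.star γ - (w + S.star γ₀) = S.star (γ - γ₀) - w := by simp; abel
    rw [e] at h1 h2
    exact ⟨fun h' => h.mem_of_interior (h1 h'), fun h' => h2 (h.sub_mem (γ := γ - γ₀) h')⟩
  refine ⟨y - γ₀, ?_, R, hR, ?_⟩
  · exact (key ⟨y, hy⟩ (Metric.mem_ball_self hR)).1 ⟨hy, hyW⟩
  · ext x
    simp only [mem_inter_iff, mem_ofPred_eq, Metric.mem_ball, dist_zero_right]
    refine and_congr_left fun hx => ?_
    have hb : x + y ∈ Metric.ball y R := by simpa using hx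
    by_cases hG : x + y ∈ S.Gam
    · rw [key ⟨x + y, hG⟩ hb, add_sub_assoc]
    · refine iff_of_false (fun h' => hG h'.1) fun h' => hG ?_
      have := S.Gam.add_mem (h.subset h') γ₀.2
      convert this using 1
      abel

theorem language_pattern_eq {w w' : Eu n} (hw : w ∈ NS S W) (hw' : w' ∈ NS S W) :
    language (S.pattern (w +ᵥ W.carrier)) = language (S.pattern (w' +ᵥ W.carrier)) :=
  (language_subset_of_isLocalLimit (isLocalLimit_pattern hw') hw).antisymm
    (language_subset_of_isLocalLimit (isLocalLimit_pattern hw) hw')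

/-- All nonsingular vectors give the same language, so each patch of `L` may be compared with a
nonsingular model set chosen for that patch. -/
theorem IsLocalLimit.mem_hull {L : Set (Eu d)} {w : Eu n} (h : IsLocalLimit S W L w) :
    L ∈ hull S W := by
  obtain ⟨w₀, hw₀, -⟩ := h.approx 1 one_pos 0
  refine ⟨_, isNonsingular_pattern hw₀,
    Subset.antisymm ?_ (language_subset_of_isLocalLimit h hw₀)⟩
  rintro P ⟨y, hy, R, hR, rfl⟩
  obtain ⟨w', hw', -, hL⟩ := h.approx 1 one_pos (‖y‖ + R)
  rw [language_pattern_eq hw₀ hw']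
  refine ⟨y, ?_, R, hR, ?_⟩
  · exact (mem_pattern_vadd ⟨y, h.subset hy⟩ w').2
      ((hL ⟨y, h.subset hy⟩ (by simpa using hR)).1 hy)
  · ext x
    simp only [mem_inter_iff, mem_ofPred_eq, Metric.mem_ball, dist_zero_right]
    refine and_congr_left fun hx => ?_
    by_cases hG : x + y ∈ S.Gam
    · have hn : ‖x + y‖ < ‖y‖ + R := (norm_add_le x y).trans_lt (by linarith)
      rw [hL ⟨x + y, hG⟩ hn, ← mem_pattern_vadd]
    · exact iff_of_false (fun h' => hG (h.subset h')) fun h' => hG h'.1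

/-- Patterns with the language of a locally finite pattern are locally translates of it. -/
theorem exists_eq_inter_ball {L L₀ : Set (Eu d)} (hl : language L = language L₀)
    (hfin : ∀ x r, (L₀ ∩ Metric.ball x r).Finite) {y : Eu d} (hy : y ∈ L) (r : ℝ) :
    ∃ a ∈ L₀, ∀ x, ‖x‖ < r → (x + y ∈ L ↔ x + a ∈ L₀) := by
  by_contra! hcon
  -- A patch in the language does not record its radius. The patch of `L` at `y` is one of `L₀` at
  -- some `a`, and the assumed disagreement forces the radius there to be less than `r`.
  have hR : ∀ R, 0 < R → r ≤ R → ∃ a ∈ L₀, ∃ R', 0 < R' ∧ R' < r ∧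
      {x | x + y ∈ L} ∩ Metric.ball 0 R = {x | x + a ∈ L₀} ∩ Metric.ball 0 R' := by
    intro R hR hrR
    have : {x | x + y ∈ L} ∩ Metric.ball 0 R ∈ language L₀ := hl ▸ ⟨y, hy, R, hR, rfl⟩
    obtain ⟨a, ha, R', hR', e⟩ := this
    refine ⟨a, ha, R', hR', ?_, e⟩
    by_contra! hle
    obtain ⟨x, hx, h⟩ := hcon a ha
    have := Set.ext_iff.1 e x
    simp only [mem_inter_iff, mem_ofPred_eq, Metric.mem_ball, dist_zero_right, hx.trans_le hrR,
      hx.trans_le hle, and_true] at this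
    rcases h with h | h
    · exact h.2 (this.1 h.1)
    · exact h.1 (this.2 h.2)
  have hbdd : ∀ x, x + y ∈ L → ‖x‖ < r := by
    intro x hx
    obtain ⟨a, ha, R', hR', hlt, e⟩ := hR (max r (‖x‖ + 1)) (by positivity) (le_max_left _ _)
    have hx' : x ∈ {x | x + y ∈ L} ∩ Metric.ball 0 (max r (‖x‖ + 1)) :=
      ⟨hx, by rw [mem_ball_zero_iff]; exact (lt_add_one _).trans_le (le_max_right _ _)⟩
    rw [e] at hx'
    exact (mem_ball_zero_iff.1 hx'.2).trans hlt
  obtain ⟨a, ha, R', hR', hlt, e⟩ := hR (max r 1) (by positivity) (le_max_left _ _)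
  have e' : {x | x + y ∈ L} = {x | x + a ∈ L₀} ∩ Metric.ball 0 R' := by
    rw [← e]
    refine (inter_eq_left.2 fun x hx => ?_).symm
    rw [mem_ball_zero_iff]
    exact (hbdd x hx).trans_le (le_max_left _ _)
  have hfinA : ∀ b ρ, ({x | x + b ∈ L₀} ∩ Metric.ball 0 ρ).Finite := by
    intro b ρ
    refine Finite.of_finite_image (f := fun x => x + b) ((hfin b ρ).subset ?_)
      (add_left_injective b).injOn
    rintro _ ⟨x, ⟨hx, hxρ⟩, rfl⟩
    exact ⟨hx, by simpa using hxρ⟩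
  have hr : 0 < r := hR'.trans hlt
  -- The patch of radius `r` at `a` has strictly more points than the finite set `L`, yet it occurs
  -- in `L`; counting gives the contradiction.
  have hlang : {x | x + a ∈ L₀} ∩ Metric.ball 0 r ∈ language L := hl ▸ ⟨a, ha, r, hr, rfl⟩
  obtain ⟨b, hb, ρ, hρ, eb⟩ := hlang
  have hss : {x | x + y ∈ L} ⊂ {x | x + a ∈ L₀} ∩ Metric.ball 0 r := by
    rw [e']
    refine ⟨fun x hx => ⟨hx.1, Metric.ball_subset_ball hlt.le hx.2⟩, fun hsub => ?_⟩
    obtain ⟨x, hx, h⟩ := hcon a ha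
    have h1 := Set.ext_iff.1 e' x
    have h2 := @hsub x
    simp only [mem_inter_iff, mem_ofPred_eq, mem_ball_zero_iff] at h1 h2
    rcases h with h | h
    · exact h.2 (h1.1 h.1).1
    · exact h.1 (h1.2 (h2 ⟨h.2, hx⟩))
  have hc1 : {x | x + y ∈ L}.ncard < ({x | x + a ∈ L₀} ∩ Metric.ball 0 r).ncard :=
    ncard_lt_ncard hss (hfinA a r)
  have hfy : {x | x + y ∈ L}.Finite := e' ▸ hfinA a R'
  have hc2 : ({x | x + a ∈ L₀} ∩ Metric.ball 0 r).ncard ≤ {x | x + y ∈ L}.ncard := by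
    rw [eb]
    refine ncard_le_ncard_of_injOn (fun x => x + b - y) ?_ ?_ hfy
    · rintro x ⟨hx, -⟩
      simpa using hx
    · intro x _ x' _ h
      simpa using h
  omega

theorem IsNonsingular.exists_mem_NS {L : Set (Eu d)} (h : IsNonsingular S W L) :
    ∃ w ∈ NS S W, ∃ t, L = {x | x + t ∈ S.pattern (w +ᵥ W.carrier)} := by
  obtain ⟨w, t, h1, h2⟩ := h
  refine ⟨w, (mem_NS S W).2 fun γ hγ => ?_, t, h2⟩
  have : (γ : Eu d) - t ∈ L := by
    rw [h2]
    simpa [mem_pattern_vadd] using hγ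
  rw [h1] at this
  simp only [mem_ofPred_eq, sub_add_cancel] at this
  rw [S.mem_pattern, W.mem_vadd_interior_iff] at this
  exact this

/-- On larger and larger balls `L` agrees with nonsingular model sets. As all of them contain a
fixed point `γ₀` of `L`, their parameters stay in the compact set `γ₀* - W`, and a limit of a
subsequence serves as `w`. -/
theorem Internal.exists_isLocalLimit (L : Internal S W) :
    ∃ w, IsLocalLimit S W L.1 w := by
  obtain ⟨L, ⟨L₀, hL₀, hl⟩, hG⟩ := L
  obtain ⟨w₀, hw₀, t, rfl⟩ := hL₀.exists_mem_NS
  have hne : ∃ y, y ∈ L := by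
    obtain ⟨γ, hγ⟩ := S.exists_star_mem (U := (fun x => x - w₀) ⁻¹' interior W.carrier)
      (isOpen_interior.preimage (by fun_prop)) (by
        obtain ⟨x, hx⟩ := W.interior_nonempty
        exact ⟨x + w₀, by simpa using hx⟩)
    have h1 : (γ : Eu d) - t ∈ {x | x + t ∈ S.pattern (w₀ +ᵥ W.carrier)} := by
      simpa [mem_pattern_vadd] using interior_subset hγ
    have : {x | x + ((γ : Eu d) - t) ∈ {x | x + t ∈ S.pattern (w₀ +ᵥ W.carrier)}} ∩
        Metric.ball 0 1 ∈ language L := hl ▸ ⟨_, h1, 1, one_pos, rfl⟩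
    obtain ⟨y, hy, -⟩ := this
    exact ⟨y, hy⟩
  obtain ⟨y, hy⟩ := hne
  obtain ⟨γ₀, rfl⟩ : ∃ γ₀ : S.Gam, (γ₀ : Eu d) = y := ⟨⟨y, hG hy⟩, rfl⟩
  have hfin : ∀ x r, ({x | x + t ∈ S.pattern (w₀ +ᵥ W.carrier)} ∩ Metric.ball x r).Finite := by
    intro x r
    refine Finite.of_finite_image (f := fun x => x + t) ((S.finite_pattern_inter
      (A := w₀ +ᵥ W.carrier) (W.isCompact.isBounded.vadd w₀)
      (Metric.isBounded_ball (x := x + t) (r := r))).subset ?_) (add_left_injective t).injOn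
    rintro _ ⟨z, ⟨hz, hzr⟩, rfl⟩
    exact ⟨hz, by simpa using hzr⟩
  have hseq : ∀ R : ℕ, ∃ w' ∈ NS S W, S.star γ₀ - w' ∈ W.carrier ∧
      ∀ γ : S.Gam, ‖(γ : Eu d)‖ < R → ((γ : Eu d) ∈ L ↔ S.star γ - w' ∈ W.carrier) := by
    intro R
    -- The comparison is centred at `γ₀`, hence the radius. Since `a + t` lies in `Γ`, the
    -- translation `t`, itself perhaps outside `Γ`, is absorbed into the parameter.
    obtain ⟨a, ha, hL⟩ := exists_eq_inter_ball hl hfin hy (R + ‖(γ₀ : Eu d)‖ + 1)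
    obtain ⟨γ₁, hγ₁⟩ : ∃ γ₁ : S.Gam, (γ₁ : Eu d) = a + t := ⟨⟨a + t, ha.1⟩, rfl⟩
    have key : ∀ γ : S.Gam, ‖(γ : Eu d) - γ₀‖ < R + ‖(γ₀ : Eu d)‖ + 1 →
        ((γ : Eu d) ∈ L ↔ S.star γ - (w₀ + S.star (γ₀ - γ₁)) ∈ W.carrier) := by
      intro γ hγ
      have h1 := hL _ hγ
      rw [sub_add_cancel] at h1
      rw [h1]
      have e : ((γ : Eu d) - γ₀ + a) + t = ((γ - γ₀ + γ₁ : S.Gam) : Eu d) := by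
        push_cast
        rw [hγ₁, add_assoc]
      rw [mem_ofPred_eq, e, mem_pattern_vadd]
      have e2 : S.star (γ - γ₀ + γ₁) - w₀ = S.star γ - (w₀ + S.star (γ₀ - γ₁)) := by
        simp; abel
      rw [e2]
    refine ⟨_, add_star_mem_NS S W hw₀ (γ₀ - γ₁), (key γ₀ (by simp; positivity)).1 hy,
      fun γ hγ => key γ ?_⟩
    have := norm_sub_le (γ : Eu d) γ₀
    linarith
  choose u hu hu0 huL using hseq
  have hcomp : IsCompact ((fun x => S.star γ₀ - x) '' W.carrier) :=
    W.isCompact.image (by fun_prop)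
  obtain ⟨w, -, φ, hφ, hlim⟩ := hcomp.tendsto_subseq (x := u) fun k => ⟨_, hu0 k, by simp⟩
  refine ⟨w, hG, fun ε hε R => ?_⟩
  have h1 := Metric.tendsto_nhds.1 hlim ε hε
  have h2 : ∀ᶠ k in atTop, R ≤ (φ k : ℝ) :=
    (tendsto_natCast_atTop_atTop.comp hφ.tendsto_atTop).eventually_ge_atTop R
  obtain ⟨k, hk1, hk2⟩ := (h1.and h2).exists
  exact ⟨u (φ k), hu _, hk1, fun γ hγ => huL _ γ (hγ.trans_le hk2)⟩

theorem IsLocalLimit.isParam {L : Internal S W} {w : Eu n} (h : IsLocalLimit S W L.1 w) :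
    IsParam S W L w := by
  constructor
  · rintro x ⟨hx, hw⟩
    exact h.mem_of_interior (γ := ⟨x, hx⟩) (W.mem_vadd_interior_iff.1 hw)
  · intro x hx
    exact ⟨h.subset hx, W.mem_vadd_iff_sub.2 (h.sub_mem (γ := ⟨x, h.subset hx⟩) hx)⟩

/-- A vector `w` is determined by `𝔓(w + W°)`, up to a translate of the closed window. -/
theorem eq_of_forall_star {w w' : Eu n} (h : ∀ γ : S.Gam, S.star γ - w ∈ interior W.carrier →
    S.star γ - w' ∈ W.carrier) : w = w' := by
  refine W.eq_of_vadd_interior_subset fun x hx => ?_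
  have hcl : IsClosed (w' +ᵥ W.carrier) := W.isClosed.vadd w'
  have hop : IsOpen (w +ᵥ interior W.carrier) := isOpen_interior.vadd w
  refine closure_minimal ?_ hcl (S.dense_gamStar.open_subset_closure_inter hop hx)
  rintro y ⟨hy, hyG⟩
  obtain ⟨γ, rfl⟩ := S.exists_star_eq hyG
  exact W.mem_vadd_iff_sub.2 (h γ (W.mem_vadd_interior_iff.1 hy))

theorem IsParam.eq {L : Internal S W} {w w' : Eu n} (h : IsParam S W L w)
    (h' : IsParam S W L w') : w = w' := by
  refine eq_of_forall_star (S := S) (W := W) fun γ hγ => ?_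
  rw [← mem_pattern_vadd]
  exact h'.2 (h.1 ((S.mem_pattern γ _).2 (W.mem_vadd_interior_iff.2 hγ)))

theorem Internal.isLocalLimit (L : Internal S W) : IsLocalLimit S W L.1 (param S W L) := by
  obtain ⟨w, hw⟩ := L.exists_isLocalLimit
  have : IsParam S W L (param S W L) := Classical.epsilon_spec ⟨w, hw.isParam⟩
  rwa [this.eq hw.isParam]

theorem isParam_iff (L : Internal S W) (w : Eu n) : IsParam S W L w ↔ w = param S W L :=
  ⟨fun h => h.eq L.isLocalLimit.isParam, fun h => h ▸ L.isLocalLimit.isParam⟩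

theorem IsLocalLimit.param_eq {L : Internal S W} {w : Eu n} (h : IsLocalLimit S W L.1 w) :
    param S W L = w := L.isLocalLimit.isParam.eq h.isParam

theorem Internal.sub_mem (L : Internal S W) {γ : S.Gam} (h : (γ : Eu d) ∈ L.1) :
    S.star γ - param S W L ∈ W.carrier := L.isLocalLimit.sub_mem h

theorem Internal.exists_mem (L : Internal S W) : ∃ γ : S.Gam, (γ : Eu d) ∈ L.1 := by
  obtain ⟨γ, hγ⟩ := S.exists_star_mem (U := (fun x => x - param S W L) ⁻¹' interior W.carrier)
    (isOpen_interior.preimage (by fun_prop)) (by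
      obtain ⟨x, hx⟩ := W.interior_nonempty
      exact ⟨x + param S W L, by simpa using hx⟩)
  exact ⟨γ, L.isLocalLimit.mem_of_interior hγ⟩

variable (S W) in
/-- The nonsingular model set of a nonsingular vector, as a member of the internal system. -/
def nonsingularModel (w : NS S W) : Internal S W :=
  ⟨S.pattern ((w : Eu n) +ᵥ W.carrier), (isLocalLimit_pattern w.2).mem_hull, S.pattern_subset _⟩

@[simp]
theorem param_nonsingularModel (w : NS S W) : param S W (nonsingularModel S W w) = w :=
  IsLocalLimit.param_eq (isLocalLimit_pattern w.2)

theorem mem_nonsingularModel (w : NS S W) (γ : S.Gam) :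
    (γ : Eu d) ∈ (nonsingularModel S W w).1 ↔ S.star γ - w ∈ W.carrier := mem_pattern_vadd γ _

end Hull
-- Topology of the internal system
section Hull

variable {n d : ℕ} {S : CutProject n d} {W : Window n}

theorem Internal.mem_nhds_iff {L : Internal S W} {U : Set (Internal S W)} :
    U ∈ 𝓝 L ↔ ∃ K : Set (Eu d), IsCompact K ∧
      ∀ L' : Internal S W, L.1 ∩ K = L'.1 ∩ K → L' ∈ U := by
  rw [_root_.mem_nhds_iff]
  constructor
  · rintro ⟨V, hVU, hV, hL⟩
    obtain ⟨K, hK, h⟩ := hV L hL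
    exact ⟨K, hK, fun L' e => hVU (h L' e)⟩
  · rintro ⟨K, hK, h⟩
    exact ⟨{L' | L.1 ∩ K = L'.1 ∩ K}, h, fun L' hL' => ⟨K, hK, fun L'' e => Eq.trans hL' e⟩, rfl⟩

theorem Internal.ext_gam {L L' : Internal S W}
    (h : ∀ γ : S.Gam, (γ : Eu d) ∈ L.1 ↔ (γ : Eu d) ∈ L'.1) : L = L' := by
  refine Subtype.ext (Set.ext fun x => ⟨fun hx => ?_, fun hx => ?_⟩)
  · exact (h ⟨x, L.2.2 hx⟩).1 hx
  · exact (h ⟨x, L'.2.2 hx⟩).2 hx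

/-- The topology of the internal system is that of pointwise convergence on `Γ`. -/
theorem Internal.tendsto_iff {ι : Type*} {l : Filter ι} {f : ι → Internal S W}
    {L : Internal S W} : Tendsto f l (𝓝 L) ↔
      ∀ γ : S.Gam, ∀ᶠ i in l, ((γ : Eu d) ∈ (f i).1 ↔ (γ : Eu d) ∈ L.1) := by
  constructor
  · intro h γ
    refine h.eventually (p := fun L' : Internal S W => ((γ : Eu d) ∈ L'.1 ↔ (γ : Eu d) ∈ L.1))
      (Internal.mem_nhds_iff.2 ⟨{(γ : Eu d)}, isCompact_singleton, ?_⟩)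
    intro L' e
    have := Set.ext_iff.1 e γ
    simpa using this.symm
  · intro h U hU
    obtain ⟨K, hK, hKU⟩ := Internal.mem_nhds_iff.1 hU
    obtain ⟨γ₀, hγ₀⟩ := L.exists_mem
    -- A pattern containing `γ₀` has all its star images in the bounded set `γ₀* - W + W`, so that
    -- finitely many points decide it on `K`.
    have hA : Bornology.IsBounded (((fun x => S.star γ₀ - x) '' W.carrier) + W.carrier) :=
      ((W.isCompact.image (by fun_prop)).add W.isCompact).isBounded
    have key : ∀ L' : Internal S W, (γ₀ : Eu d) ∈ L'.1 → ∀ γ : S.Gam, (γ : Eu d) ∈ L'.1 →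
        S.star γ ∈ ((fun x => S.star γ₀ - x) '' W.carrier) + W.carrier := by
      intro L' h0 γ hγ
      exact ⟨_, ⟨_, L'.sub_mem h0, rfl⟩, _, L'.sub_mem hγ, by simp⟩
    change ∀ᶠ i in l, f i ∈ U
    filter_upwards [(eventually_all_finite (S.finite_star_mem hA hK.isBounded)).2
      fun γ _ => h γ, h γ₀] with i hi hi0
    refine hKU _ (Set.ext fun x => and_congr_left fun hxK => ⟨fun hx => ?_, fun hx => ?_⟩)
    · exact (hi ⟨x, L.2.2 hx⟩ ⟨hxK, key L hγ₀ _ hx⟩).2 hx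
    · exact (hi ⟨x, (f i).2.2 hx⟩ ⟨hxK, key (f i) (hi0.2 hγ₀) _ hx⟩).1 hx

theorem param_eq_of {L : Internal S W} {w : Eu n}
    (h1 : ∀ γ : S.Gam, S.star γ - w ∈ interior W.carrier → (γ : Eu d) ∈ L.1)
    (h2 : ∀ γ : S.Gam, (γ : Eu d) ∈ L.1 → S.star γ - w ∈ W.carrier) : param S W L = w := by
  refine ((isParam_iff L w).1 ⟨?_, ?_⟩).symm
  · rintro x ⟨hx, hw⟩
    exact h1 ⟨x, hx⟩ (W.mem_vadd_interior_iff.1 hw)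
  · intro x hx
    exact ⟨L.2.2 hx, W.mem_vadd_iff_sub.2 (h2 ⟨x, L.2.2 hx⟩ hx)⟩

/-- Patterns containing a fixed point have parameters in a compact set, so the parameters converge
along an ultrafilter. Interior points of the window of `L` persist and lie in the closed limit
window, which identifies the limit. -/
theorem continuous_param : Continuous (param S W) := by
  refine continuous_iff_ultrafilter.2 fun L u hu => ?_
  have ht := Internal.tendsto_iff.1 (show Tendsto id (u : Filter (Internal S W)) (𝓝 L) from hu)
  obtain ⟨γ₀, hγ₀⟩ := L.exists_mem
  have hc : IsCompact ((fun x => S.star γ₀ - x) '' W.carrier) := W.isCompact.image (by fun_prop)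
  have hev : (fun x => S.star γ₀ - x) '' W.carrier ∈ u.map (param S W) := by
    have : ∀ᶠ L' in (u : Filter (Internal S W)),
        param S W L' ∈ (fun x => S.star γ₀ - x) '' W.carrier := by
      filter_upwards [ht γ₀] with L' hL'
      exact ⟨_, L'.sub_mem (hL'.2 hγ₀), by simp⟩
    exact this
  obtain ⟨w, -, hw⟩ := hc.ultrafilter_le_nhds' _ hev
  have hw' : Tendsto (param S W) u (𝓝 w) := hw
  have e : param S W L = w := by
    refine eq_of_forall_star (S := S) (W := W) fun γ hγ => ?_
    have hl : Tendsto (fun L' => S.star γ - param S W L') u (𝓝 (S.star γ - w)) :=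
      tendsto_const_nhds.sub hw'
    refine W.isClosed.mem_of_tendsto hl ?_
    filter_upwards [ht γ] with L' hL'
    exact L'.sub_mem (hL'.2 (L.isLocalLimit.mem_of_interior hγ))
  rwa [e]

/-- Local compactness of the internal system. -/
theorem Internal.exists_tendsto {ι : Type*} (u : Ultrafilter ι) (f : ι → Internal S W) {w : Eu n}
    (h : Tendsto (fun i => param S W (f i)) u (𝓝 w)) :
    ∃ L, Tendsto f u (𝓝 L) ∧ param S W L = w := by
  -- The pointwise limit along the ultrafilter; the convergent parameters keep it inside a bounded
  -- window, and so make it a local limit.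
  let L : Set (Eu d) := {x | ∀ᶠ i in (u : Filter ι), x ∈ (f i).1}
  have hloc : IsLocalLimit S W L w := by
    constructor
    · intro x hx
      obtain ⟨i, hi⟩ := Eventually.exists hx
      exact (f i).2.2 hi
    · intro ε hε R
      have hA : Bornology.IsBounded (W.carrier + Metric.ball w 1) :=
        W.isCompact.isBounded.add Metric.isBounded_ball
      have hfin := S.finite_star_mem hA (Metric.isBounded_ball (x := (0 : Eu d)) (r := R))
      have hmem : ∀ L' : Internal S W, dist (param S W L') w < 1 → ∀ γ : S.Gam,
          (γ : Eu d) ∈ L'.1 → S.star γ ∈ W.carrier + Metric.ball w 1 := by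
        intro L' hd γ hγ
        exact ⟨_, L'.sub_mem hγ, _, hd, by simp⟩
      have hagree : ∀ γ : S.Gam, ∀ᶠ i in (u : Filter ι),
          ((γ : Eu d) ∈ (f i).1 ↔ (γ : Eu d) ∈ L) := by
        intro γ
        by_cases hγ : (γ : Eu d) ∈ L
        · filter_upwards [show ∀ᶠ i in (u : Filter ι), (γ : Eu d) ∈ (f i).1 from hγ] with i hi
          exact iff_of_true hi hγ
        · filter_upwards [Ultrafilter.eventually_not.2 hγ] with i hi
          exact iff_of_false hi hγ
      have h1 := Metric.tendsto_nhds.1 h 1 one_pos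
      obtain ⟨i, hi1, hi2, hi3⟩ := (h1.and ((Metric.tendsto_nhds.1 h (ε / 2) (half_pos hε)).and
        ((eventually_all_finite hfin).2 fun γ _ => hagree γ))).exists
      obtain ⟨w', hw', hd, hR⟩ := (f i).isLocalLimit.approx (ε / 2) (half_pos hε) R
      refine ⟨w', hw', ?_, fun γ hγ => ?_⟩
      · linarith [dist_triangle w' (param S W (f i)) w]
      · rw [← hR γ hγ]
        by_cases hγA : S.star γ ∈ W.carrier + Metric.ball w 1
        · exact (hi3 γ ⟨by simpa using hγ, hγA⟩).symm
        · refine iff_of_false (fun hL => hγA ?_) fun hL => hγA (hmem _ hi1 γ hL)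
          obtain ⟨j, hj1, hj2⟩ := (h1.and hL).exists
          exact hmem _ hj1 γ hj2
  let L' : Internal S W := ⟨L, hloc.mem_hull, hloc.subset⟩
  refine ⟨L', Internal.tendsto_iff.2 fun γ => ?_, hloc.param_eq (L := L')⟩
  by_cases hγ : (γ : Eu d) ∈ L
  · filter_upwards [show ∀ᶠ i in (u : Filter ι), (γ : Eu d) ∈ (f i).1 from hγ] with i hi
    exact iff_of_true hi hγ
  · filter_upwards [Ultrafilter.eventually_not.2 hγ] with i hi
    exact iff_of_false hi hγ

theorem mem_translate (γ γ' : S.Gam) (L : Internal S W) :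
    (γ' : Eu d) ∈ (translate S W γ L).1 ↔ ((γ' - γ : S.Gam) : Eu d) ∈ L.1 := Iff.rfl

@[simp]
theorem param_translate (γ : S.Gam) (L : Internal S W) :
    param S W (translate S W γ L) = param S W L + S.star γ := by
  refine param_eq_of (fun γ' h => ?_) fun γ' h => ?_
  · rw [mem_translate]
    refine L.isLocalLimit.mem_of_interior ?_
    rw [S.star_sub, sub_sub, add_comm]
    exact h
  · rw [mem_translate] at h
    have := L.sub_mem h
    rwa [S.star_sub, sub_sub, add_comm] at this

theorem translate_nonsingularModel (γ : S.Gam) (w : NS S W) :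
    translate S W γ (nonsingularModel S W w) =
      nonsingularModel S W ⟨w + S.star γ, add_star_mem_NS S W w.2 γ⟩ := by
  refine Internal.ext_gam fun γ' => ?_
  rw [mem_translate, mem_nonsingularModel, mem_nonsingularModel]
  simp [sub_sub, add_comm]

/-- This reduces equivalences between clopen conditions to nonsingular model sets, where half spaces
are explicit. -/
theorem dense_range_nonsingularModel : DenseRange (nonsingularModel S W) := by
  intro L
  have hloc := L.isLocalLimit
  have : ∀ k : ℕ, ∃ w : NS S W, ∀ γ : S.Gam, ‖(γ : Eu d)‖ < k →
      ((γ : Eu d) ∈ (nonsingularModel S W w).1 ↔ (γ : Eu d) ∈ L.1) := by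
    intro k
    obtain ⟨w', hw', -, h⟩ := hloc.approx 1 one_pos k
    exact ⟨⟨w', hw'⟩, fun γ hγ => (mem_nonsingularModel _ γ).trans (h γ hγ).symm⟩
  choose f hf using this
  have ht : Tendsto (fun k => nonsingularModel S W (f k)) atTop (𝓝 L) := by
    refine Internal.tendsto_iff.2 fun γ => ?_
    filter_upwards [tendsto_natCast_atTop_atTop.eventually_gt_atTop ‖(γ : Eu d)‖] with k hk
    exact hf k γ hk
  exact mem_closure_of_tendsto ht (Eventually.of_forall fun k => mem_range_self _)

theorem exists_mem_NS_of_isOpen {U : Set (Eu n)} (hU : IsOpen U) (hne : U.Nonempty) :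
    ∃ w : NS S W, (w : Eu n) ∈ U := by
  obtain ⟨w, hw, hwU⟩ := (dense_NS S W).exists_mem_open hU hne
  exact ⟨⟨w, hw⟩, hwU⟩

instance : Nonempty (Internal S W) :=
  let ⟨w, _⟩ := exists_mem_NS_of_isOpen (S := S) (W := W) isOpen_univ univ_nonempty
  ⟨nonsingularModel S W w⟩

end Hull
-- Facets of a full-dimensional polytope
section Polytope

variable {n : ℕ} {M : Set (Eu n)}

/-- By Krein–Milman a face is recovered from its extreme points, which belong to the finite set `F`.
-/
theorem finite_isExposed (hM : ∃ F : Set (Eu n), F.Finite ∧ M = convexHull ℝ F) :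
    {f | IsExposed ℝ M f}.Finite := by
  obtain ⟨F, hF, h⟩ := hM
  have hc : IsCompact M := by rw [h]; exact hF.isCompact_convexHull ℝ
  have hconv : Convex ℝ M := by rw [h]; exact convex_convexHull ℝ F
  refine (hF.finite_subsets.image fun G : Set (Eu n) => closure (convexHull ℝ G)).subset ?_
  intro f hf
  have h1 := hf.isExtreme.extremePoints_subset_extremePoints
  have h2 : extremePoints ℝ M ⊆ F := by rw [h]; exact extremePoints_convexHull_subset
  exact ⟨extremePoints ℝ f, h1.trans h2,
    closure_convexHull_extremePoints (hf.isCompact hc) (hf.convex hconv)⟩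

/-- The face of `M` on which a linear form is maximal. -/
def maxFace (M : Set (Eu n)) (l : StrongDual ℝ (Eu n)) : Set (Eu n) :=
  {x ∈ M | ∀ y ∈ M, l y ≤ l x}

theorem isExposed_maxFace (l : StrongDual ℝ (Eu n)) : IsExposed ℝ M (maxFace M l) :=
  fun _ => ⟨l, rfl⟩

theorem vectorSpan_maxFace_le (l : StrongDual ℝ (Eu n)) :
    vectorSpan ℝ (maxFace M l) ≤ LinearMap.ker (l : Eu n →ₗ[ℝ] ℝ) := by
  rw [vectorSpan, Submodule.span_le]
  rintro _ ⟨x, hx, y, hy, rfl⟩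
  have := le_antisymm (hx.2 y hy.1) (hy.2 x hx.1)
  simp [this]

theorem finrank_ker_add_one {l : Eu n →ₗ[ℝ] ℝ} (hl : l ≠ 0) :
    Module.finrank ℝ (LinearMap.ker l) + 1 = n := by
  have h1 := LinearMap.finrank_range_add_finrank_ker l
  rw [LinearMap.range_eq_top.2 (LinearMap.surjective hl)] at h1
  simp at h1
  omega

theorem lt_of_mem_interior {l : StrongDual ℝ (Eu n)} (hl : l ≠ 0) {b : ℝ}
    (h : ∀ x ∈ M, l x ≤ b) {y : Eu n} (hy : y ∈ interior M) : l y < b := by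
  have ho := l.isOpenMap_of_ne_zero hl _ (isOpen_interior (s := M))
  have hsub : l '' interior M ⊆ Iic b := by
    rintro _ ⟨x, hx, rfl⟩
    exact h x (interior_subset hx)
  have := interior_maximal hsub ho ⟨y, hy, rfl⟩
  rwa [interior_Iic] at this

open MeasureTheory in
/-- A point outside a full-dimensional polytope is separated from it by a facet. -/
theorem exists_isFacet_lt (hM : ∃ F : Set (Eu n), F.Finite ∧ M = convexHull ℝ F)
    (hint : (interior M).Nonempty) {x : Eu n} (hx : x ∉ M) :
    ∃ l : StrongDual ℝ (Eu n), IsFacet M (maxFace M l) ∧ ∀ p ∈ maxFace M l, l p < l x := by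
  have hc : IsCompact M := by
    obtain ⟨F, hF, h⟩ := hM
    rw [h]; exact hF.isCompact_convexHull ℝ
  have hconv : Convex ℝ M := by
    obtain ⟨F, hF, h⟩ := hM
    rw [h]; exact convex_convexHull ℝ F
  let low : Set (Set (Eu n)) :=
    {f | IsExposed ℝ M f ∧ Module.finrank ℝ (vectorSpan ℝ f) + 1 < n}
  have hlow : low.Finite := (finite_isExposed hM).subset fun f hf => hf.1
  -- A face of codimension at least two spans together with `x` a proper affine subspace. These are
  -- finitely many null sets, so some interior point avoids them.
  obtain ⟨y, hy, hyl⟩ : ∃ y ∈ interior M, ∀ f ∈ low, y ∉ affineSpan ℝ (insert x f) := by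
    by_contra! hcon
    have hnull : volume (⋃ f ∈ low, (affineSpan ℝ (insert x f) : Set (Eu n))) = 0 := by
      refine (measure_biUnion_null_iff hlow.countable).2 fun f hf => ?_
      refine Measure.addHaar_affineSubspace volume _ fun htop => ?_
      have h1 := finrank_vectorSpan_insert_le_set ℝ f x
      rw [← direction_affineSpan, htop, AffineSubspace.direction_top, finrank_top,
        finrank_euclideanSpace_fin] at h1
      have := hf.2
      omega
    have hpos := isOpen_interior.measure_pos volume hint
    refine hpos.ne' (measure_mono_null (fun y hy => ?_) hnull)
    obtain ⟨f, hf, h⟩ := hcon y hy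
    exact mem_biUnion hf h
  let c : ℝ → Eu n := fun t => AffineMap.lineMap x y t
  have hcc : Continuous c := AffineMap.lineMap_continuous
  have hK : IsCompact (Icc (0 : ℝ) 1 ∩ c ⁻¹' M) :=
    isCompact_Icc.inter_right (hc.isClosed.preimage hcc)
  -- `c t` is the point where the segment from `x` to `y` enters `M`; a supporting form there gives
  -- the facet.
  obtain ⟨t, ⟨⟨ht0, ht1⟩, htM⟩, hmin⟩ := hK.exists_isLeast
    ⟨1, ⟨zero_le_one, le_rfl⟩, by simpa [c] using interior_subset hy⟩
  have htpos : 0 < t := by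
    rcases ht0.eq_or_lt with h | h
    · subst h
      exact absurd (by simpa [c] using htM) hx
    · exact h
  have hbd : c t ∉ interior M := by
    intro hi
    have hev : ∀ᶠ s in 𝓝[<] t, c s ∈ interior M :=
      ((hcc.tendsto t).eventually (isOpen_interior.mem_nhds hi)).filter_mono nhdsWithin_le_nhds
    have hev2 : ∀ᶠ s in 𝓝[<] t, 0 < s :=
      (lt_mem_nhds htpos).filter_mono nhdsWithin_le_nhds
    obtain ⟨s, hs, hs0, hst⟩ := (hev.and (hev2.and self_mem_nhdsWithin)).exists
    have hst : s < t := hst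
    have hsM : c s ∈ M := interior_subset hs
    exact absurd (hmin ⟨⟨hs0.le, hst.le.trans ht1⟩, hsM⟩) (not_le.2 hst)
  obtain ⟨l, hl, hle⟩ := geometric_hahn_banach_of_nonempty_interior_point hconv hbd hint
  have hz : c t ∈ maxFace M l := ⟨htM, hle⟩
  have hl' : (l : Eu n →ₗ[ℝ] ℝ) ≠ 0 := fun h => hl (by ext v; exact LinearMap.congr_fun h v)
  have hrank : Module.finrank ℝ (vectorSpan ℝ (maxFace M l)) + 1 ≤ n := by
    have := Submodule.finrank_mono (vectorSpan_maxFace_le (M := M) l)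
    have h2 := finrank_ker_add_one hl'
    omega
  refine ⟨l, ⟨isExposed_maxFace l, ⟨_, hz⟩, ?_⟩, fun p hp => ?_⟩
  · by_contra hne
    -- Otherwise the line through `x` and `c t` would put `y` in the affine span avoided by its
    -- choice.
    refine hyl _ ⟨isExposed_maxFace l, lt_of_le_of_ne hrank hne⟩ ?_
    have h1 : x ∈ affineSpan ℝ (insert x (maxFace M l)) :=
      subset_affineSpan ℝ _ (mem_insert _ _)
    have h2 : c t ∈ affineSpan ℝ (insert x (maxFace M l)) :=
      subset_affineSpan ℝ _ (mem_insert_of_mem _ hz)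
    have h3 := AffineMap.lineMap_mem t⁻¹ h1 h2
    have e : AffineMap.lineMap x (c t) t⁻¹ = y := by
      simp only [c, AffineMap.lineMap_apply, vsub_eq_sub, vadd_eq_add, add_sub_cancel_right,
        smul_smul, inv_mul_cancel₀ htpos.ne', one_smul, sub_add_cancel]
    rwa [e] at h3
  · have h1 : l y < l (c t) := lt_of_mem_interior hl hle hy
    have h2 : l p ≤ l (c t) := hle p hp.1
    have h3 : l (c t) = t * (l y - l x) + l x := by
      simp [c, AffineMap.lineMap_apply]
    nlinarith

theorem IsFacet.exists_form {f : Set (Eu n)} (hf : IsFacet M f) {φ : Eu n →ₗ[ℝ] ℝ}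
    (hφ : LinearMap.ker φ = vectorSpan ℝ f) {l : StrongDual ℝ (Eu n)} (hl : l ≠ 0)
    (hlf : f = maxFace M l) : ∃ c : ℝ, c ≠ 0 ∧ ∀ x, φ x = c * l x := by
  have hl' : (l : Eu n →ₗ[ℝ] ℝ) ≠ 0 := fun h => hl (by ext v; exact LinearMap.congr_fun h v)
  have h1 : vectorSpan ℝ f ≤ LinearMap.ker (l : Eu n →ₗ[ℝ] ℝ) := hlf ▸ vectorSpan_maxFace_le l
  have h2 : vectorSpan ℝ f = LinearMap.ker (l : Eu n →ₗ[ℝ] ℝ) := by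
    refine Submodule.eq_of_le_of_finrank_eq h1 ?_
    have := finrank_ker_add_one hl'
    have := hf.2.2
    omega
  obtain ⟨u, hu⟩ := LinearMap.surjective hl' 1
  have hu : l u = 1 := hu
  have key : ∀ x, φ x = φ u * l x := by
    intro x
    have : x - l x • u ∈ LinearMap.ker φ := by
      rw [hφ, h2, LinearMap.mem_ker]
      simp [hu]
    rw [LinearMap.mem_ker, map_sub, map_smul, sub_eq_zero, smul_eq_mul] at this
    rw [this, mul_comm]
  refine ⟨φ u, fun h0 => ?_, key⟩
  have : u ∈ LinearMap.ker φ := h0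
  rw [hφ, h2, LinearMap.mem_ker] at this
  exact one_ne_zero (hu.symm.trans this)

/-- The exposing form is nonzero, since the zero form exposes all of `M`, whose dimension is too
large. -/
theorem IsFacet.exists_maxFace (hint : (interior M).Nonempty) {f : Set (Eu n)}
    (hf : IsFacet M f) : ∃ l : StrongDual ℝ (Eu n), l ≠ 0 ∧ f = maxFace M l := by
  obtain ⟨l, hl⟩ := hf.1 hf.2.1
  refine ⟨l, ?_, hl⟩
  rintro rfl
  have e : f = M := by rw [hl]; simp
  have h := hf.2.2
  have ht : affineSpan ℝ M = ⊤ :=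
    top_unique (isOpen_interior.affineSpan_eq_top hint ▸ affineSpan_mono ℝ interior_subset)
  rw [e, ← direction_affineSpan, ht, AffineSubspace.direction_top, finrank_top,
    finrank_euclideanSpace_fin] at h
  omega

end Polytope

/-! ### The window as an intersection of facet half spaces -/

section Window

variable {n : ℕ} {W : Window n} (o : W.Sides)

theorem Window.interior_rev_nonempty : (interior W.rev).Nonempty := by
  obtain ⟨x, hx⟩ := W.interior_nonempty
  refine ⟨-x, ?_⟩
  have h : IsOpen (-interior W.carrier) := isOpen_interior.neg
  exact interior_maximal (Set.neg_subset_neg.2 interior_subset) h (by simpa using hx)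

/-- The hyperplane parallel to a facet. -/
noncomputable def facetHyperplane {f : Set (Eu n)} (hf : IsFacet W.rev f) : W.hyperplanes :=
  ⟨vectorSpan ℝ f, f, hf, rfl⟩

theorem form_eq_of_mem {f : Set (Eu n)} (hf : IsFacet W.rev f) {p q : Eu n} (hp : p ∈ f)
    (hq : q ∈ f) : o.form (facetHyperplane hf) p = o.form (facetHyperplane hf) q := by
  have : p - q ∈ LinearMap.ker (o.form (facetHyperplane hf)) := by
    rw [o.ker_form]
    exact vsub_mem_vectorSpan ℝ hp hq
  rwa [LinearMap.mem_ker, map_sub, sub_eq_zero] at this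

/-- The value of the form of a facet on that facet. -/
noncomputable def facetValue {f : Set (Eu n)} (hf : IsFacet W.rev f) : ℝ :=
  o.form (facetHyperplane hf) hf.2.1.choose

theorem form_eq_facetValue {f : Set (Eu n)} (hf : IsFacet W.rev f) {p : Eu n} (hp : p ∈ f) :
    o.form (facetHyperplane hf) p = facetValue o hf :=
  form_eq_of_mem o hf hp hf.2.1.choose_spec

theorem mem_affSide {f : Set (Eu n)} (hf : IsFacet W.rev f) {s : SignType} {x : Eu n} :
    x ∈ affSide o f hf s ↔
      SignType.sign (o.form (facetHyperplane hf) x - facetValue o hf) = s := by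
  constructor
  · rintro ⟨p, hp, h⟩
    rw [← form_eq_facetValue o hf hp, ← map_sub]
    exact h
  · intro h
    obtain ⟨p, hp⟩ := hf.2.1
    refine ⟨p, hp, ?_⟩
    rw [← form_eq_facetValue o hf hp, ← map_sub] at h
    exact h

/-- The chosen form of the hyperplane and a form exposing the facet have the same kernel, hence are
proportional. The side is that of an arbitrary interior point. -/
theorem exists_facetSign {f : Set (Eu n)} (hf : IsFacet W.rev f) : ∃ s : SignType, s ≠ 0 ∧
    (∀ x ∈ W.rev, o.form (facetHyperplane hf) x ≠ facetValue o hf → x ∈ affSide o f hf s) ∧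
    ∀ l : StrongDual ℝ (Eu n), l ≠ 0 → f = maxFace W.rev l → ∀ p ∈ f, ∀ x, l p < l x →
      x ∉ affSide o f hf s := by
  obtain ⟨y, hy⟩ := Window.interior_rev_nonempty (W := W)
  refine ⟨SignType.sign (o.form (facetHyperplane hf) y - facetValue o hf), ?_, ?_, ?_⟩
  · obtain ⟨l, hl, hlf⟩ := hf.exists_maxFace Window.interior_rev_nonempty
    obtain ⟨c, hc, h⟩ := hf.exists_form (o.ker_form (facetHyperplane hf)) hl hlf
    obtain ⟨p, hp⟩ := hf.2.1
    have hp' := hp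
    rw [hlf] at hp'
    have := lt_of_mem_interior hl hp'.2 hy
    rw [← form_eq_facetValue o hf hp, h, h, Ne, sign_eq_zero_iff, ← mul_sub, mul_eq_zero, not_or]
    exact ⟨hc, (sub_neg.2 this).ne⟩
  · intro x hx hne
    obtain ⟨l, hl, hlf⟩ := hf.exists_maxFace Window.interior_rev_nonempty
    obtain ⟨c, hc, h⟩ := hf.exists_form (o.ker_form (facetHyperplane hf)) hl hlf
    obtain ⟨p, hp⟩ := hf.2.1
    have hp' := hp
    rw [hlf] at hp'
    have h1 := lt_of_mem_interior hl hp'.2 hy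
    have h2 := hp'.2 x hx
    rw [← form_eq_facetValue o hf hp, h, h] at hne
    have h3 : l x < l p := lt_of_le_of_ne h2 fun e => hne (by rw [e])
    rw [mem_affSide, ← form_eq_facetValue o hf hp, h, h, h, ← mul_sub, ← mul_sub, sign_mul,
      sign_mul, sign_neg (sub_neg.2 h1), sign_neg (sub_neg.2 h3)]
  · intro l hl hlf p hp x hx
    obtain ⟨c, hc, h⟩ := hf.exists_form (o.ker_form (facetHyperplane hf)) hl hlf
    have hp' := hp
    rw [hlf] at hp'
    have h1 := lt_of_mem_interior hl hp'.2 hy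
    rw [mem_affSide, ← form_eq_facetValue o hf hp, h, h, h, ← mul_sub, ← mul_sub, sign_mul,
      sign_mul, sign_neg (sub_neg.2 h1), sign_pos (sub_pos.2 hx)]
    rcases lt_or_gt_of_ne hc with h | h
    · rw [sign_neg h]; decide
    · rw [sign_pos h]; decide

/-- The side of a facet on which the polytope lies. -/
noncomputable def facetSign {f : Set (Eu n)} (hf : IsFacet W.rev f) : SignType := (exists_facetSign o hf).choose

theorem facetSign_ne_zero {f : Set (Eu n)} (hf : IsFacet W.rev f) : facetSign o hf ≠ 0 :=
  (exists_facetSign o hf).choose_spec.1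

/-- Away from the hyperplanes spanned by the facets, a full-dimensional polytope is the
intersection of its facet half spaces. -/
theorem mem_rev_iff {x : Eu n} (hx : ∀ f (hf : IsFacet W.rev f),
    o.form (facetHyperplane hf) x ≠ facetValue o hf) :
    x ∈ W.rev ↔ ∀ f (hf : IsFacet W.rev f), x ∈ affSide o f hf (facetSign o hf) := by
  constructor
  · intro h f hf
    exact (exists_facetSign o hf).choose_spec.2.1 x h (hx f hf)
  · intro h
    by_contra hc
    obtain ⟨l, hf, hlt⟩ := exists_isFacet_lt W.rev_polytope Window.interior_rev_nonempty hc
    obtain ⟨p, hp⟩ := hf.2.1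
    have hl : l ≠ 0 := by
      rintro rfl
      exact lt_irrefl _ (hlt p hp)
    exact (exists_facetSign o hf).choose_spec.2.2 l hl rfl p hp x (hlt p hp) (h _ hf)

theorem finite_isFacet : {f | IsFacet W.rev f}.Finite :=
  (finite_isExposed W.rev_polytope).subset fun _ h => h.1

end Window
-- Coding patterns by half spaces
section Signs

variable {n d : ℕ} {S : CutProject n d} {W : Window n} (o : W.Sides)

/-- The open half spaces (and the hyperplane, for `s = 0`) at level `v` of a form. -/
def levelSide (H : W.hyperplanes) (v : ℝ) (s : SignType) : Set (Eu n) :=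
  {x | SignType.sign (o.form H x - v) = s}

variable (S) in
/-- The levels of the translates of the affine hulls of the facets by `Γ*`. -/
def cutValues (H : W.hyperplanes) : Set ℝ :=
  {v | ∃ f, ∃ hf : IsFacet W.rev f, ∃ γ : S.Gam,
    facetHyperplane hf = H ∧ v = o.form H (S.star γ) + facetValue o hf}

/-- A point pattern lies above the level `v` of the form of `H`. -/
def Above (L : Internal S W) (H : W.hyperplanes) (v : ℝ) : Prop :=
  L ∈ cut S W (levelSide o H v 1)

variable {o}

theorem mem_cutValues {f : Set (Eu n)} (hf : IsFacet W.rev f) (γ : S.Gam) :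
    o.form (facetHyperplane hf) (S.star γ) + facetValue o hf ∈ cutValues S o (facetHyperplane hf) :=
  ⟨f, hf, γ, rfl, rfl⟩

theorem add_star_mem_cutValues {H : W.hyperplanes} {v : ℝ} (hv : v ∈ cutValues S o H)
    (γ : S.Gam) : v + o.form H (S.star γ) ∈ cutValues S o H := by
  obtain ⟨f, hf, γ', rfl, rfl⟩ := hv
  refine ⟨f, hf, γ' + γ, rfl, ?_⟩
  rw [S.star_add, map_add]
  ring

theorem sub_star_mem_cutValues {H : W.hyperplanes} {v : ℝ} (hv : v ∈ cutValues S o H)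
    (γ : S.Gam) : v - o.form H (S.star γ) ∈ cutValues S o H := by
  have := add_star_mem_cutValues hv (-γ)
  rwa [S.star_neg, map_neg, ← sub_eq_add_neg] at this

theorem cutValues_nonempty (H : W.hyperplanes) : (cutValues S o H).Nonempty := by
  obtain ⟨H, f, hf, rfl⟩ := H
  exact ⟨_, mem_cutValues hf 0⟩

theorem form_ne_zero (H : W.hyperplanes) : o.form H ≠ 0 := by
  obtain ⟨H, f, hf, rfl⟩ := H
  intro h
  have h1 := o.ker_form ⟨vectorSpan ℝ f, f, hf, rfl⟩
  rw [h, LinearMap.ker_zero] at h1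
  change ⊤ = vectorSpan ℝ f at h1
  have h2 := hf.2.2
  rw [← h1, finrank_top, finrank_euclideanSpace_fin] at h2
  omega

/-- The admissible half spaces of the second condition are those at the levels in `cutValues`. -/
theorem vadd_affSide {f : Set (Eu n)} (hf : IsFacet W.rev f) (y : Eu n) (s : SignType) :
    y +ᵥ affSide o f hf s =
      levelSide o (facetHyperplane hf) (o.form (facetHyperplane hf) y + facetValue o hf) s := by
  ext x
  rw [mem_vadd_set_iff_neg_vadd_mem, mem_affSide, vadd_eq_add, map_add, map_neg]
  change _ ↔ SignType.sign _ = s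
  rw [show -o.form (facetHyperplane hf) y + o.form (facetHyperplane hf) x - facetValue o hf =
    o.form (facetHyperplane hf) x - (o.form (facetHyperplane hf) y + facetValue o hf) by ring]

theorem le_form_param_of_mem_cut {L : Internal S W} {H : W.hyperplanes} {v : ℝ}
    (h : L ∈ cut S W (levelSide o H v 1)) : v ≤ o.form H (param S W L) := by
  have hc : IsClosed {L : Internal S W | v ≤ o.form H (param S W L)} :=
    isClosed_le continuous_const
      ((o.form H).continuous_of_finiteDimensional.comp continuous_param)
  refine closure_minimal ?_ hc h
  rintro L' ⟨w, ⟨hw, hNS⟩, e⟩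
  have : L' = nonsingularModel S W ⟨w, hNS⟩ := Subtype.ext e
  subst this
  have hw : SignType.sign (o.form H w - v) = 1 := hw
  rw [sign_eq_one_iff, sub_pos] at hw
  simpa using hw.le

theorem form_param_le_of_mem_cut {L : Internal S W} {H : W.hyperplanes} {v : ℝ}
    (h : L ∈ cut S W (levelSide o H v (-1))) : o.form H (param S W L) ≤ v := by
  have hc : IsClosed {L : Internal S W | o.form H (param S W L) ≤ v} :=
    isClosed_le ((o.form H).continuous_of_finiteDimensional.comp continuous_param)
      continuous_const
  refine closure_minimal ?_ hc h
  rintro L' ⟨w, ⟨hw, hNS⟩, e⟩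
  have : L' = nonsingularModel S W ⟨w, hNS⟩ := Subtype.ext e
  subst this
  have hw : SignType.sign (o.form H w - v) = -1 := hw
  rw [sign_eq_neg_one_iff, sub_neg] at hw
  simpa using hw.le

theorem nonsingularModel_mem_cut {A : Set (Eu n)} (w : NS S W) (hw : (w : Eu n) ∈ A) :
    nonsingularModel S W w ∈ cut S W A := subset_closure ⟨w, ⟨hw, w.2⟩, rfl⟩

theorem isClosed_setOf_iff {X : Type*} [TopologicalSpace X] {p q : X → Prop}
    (hp : IsClopen {x | p x}) (hq : IsClopen {x | q x}) : IsClosed {x | p x ↔ q x} := by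
  have : {x | p x ↔ q x} = ({x | p x} ∩ {x | q x}) ∪ ({x | p x}ᶜ ∩ {x | q x}ᶜ) := by
    ext x
    simp only [mem_ofPred_eq, mem_union, mem_inter_iff, mem_compl_iff]
    tauto
  rw [this]
  exact ((hp.inter hq).union (hp.compl.inter hq.compl)).isClosed

theorem Internal.isClopen_mem (γ : S.Gam) : IsClopen {L : Internal S W | (γ : Eu d) ∈ L.1} := by
  have : ∀ (L : Internal S W), ∀ᶠ L' in 𝓝 L, ((γ : Eu d) ∈ L'.1 ↔ (γ : Eu d) ∈ L.1) :=
    fun L => (Internal.tendsto_iff (f := id)).1 tendsto_id γ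
  constructor
  · refine isOpen_compl_iff.1 (isOpen_iff_mem_nhds.2 fun L hL => ?_)
    filter_upwards [this L] with L' hL' h
    exact hL (hL'.1 h)
  · refine isOpen_iff_mem_nhds.2 fun L hL => ?_
    filter_upwards [this L] with L' hL'
    exact hL'.2 hL

variable (hW : AlmostCanonical S W o)
include hW

/-- The first condition: a point of `γ* + A_f` is moved by `Γ* ∩ H_f` into `γ* + f`, so a vector
there puts a point of `Γ*` on the boundary of its window and is singular. -/
theorem form_ne_of_mem_NS {w : Eu n} (hw : w ∈ NS S W) {H : W.hyperplanes} {v : ℝ}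
    (hv : v ∈ cutValues S o H) : o.form H w ≠ v := by
  obtain ⟨f, hf, γ, rfl, rfl⟩ := hv
  intro h
  have hA : w - S.star γ ∈ affineSpan ℝ f := by
    obtain ⟨p, hp⟩ := hf.2.1
    have h1 : w - S.star γ - p ∈ vectorSpan ℝ f := by
      have := o.ker_form (facetHyperplane hf)
      change _ = vectorSpan ℝ f at this
      rw [← this, LinearMap.mem_ker, map_sub, map_sub, h, form_eq_facetValue o hf hp]
      ring
    rw [← direction_affineSpan] at h1
    have := AffineSubspace.vadd_mem_of_mem_direction h1 (subset_affineSpan ℝ f hp)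
    simpa using this
  obtain ⟨y, ⟨hy, -⟩, q, hq, e⟩ := hW.1 f hf hA
  obtain ⟨γ', rfl⟩ := S.exists_star_eq hy
  have e : S.star γ' + q = w - S.star γ := e
  have e' : S.star (γ' + γ) - w = -q := by
    rw [S.star_add]
    have : w = S.star γ' + q + S.star γ := by rw [e]; abel
    rw [this]; abel
  have hqM : q ∈ W.rev := hf.1.subset hq
  have hi := (mem_NS S W).1 hw (γ' + γ) (by rw [e']; exact hqM)
  rw [e'] at hi
  have hqi : q ∈ interior W.rev := by
    have ho : IsOpen (-interior W.carrier) := isOpen_interior.neg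
    exact interior_maximal (Set.neg_subset_neg.2 interior_subset) ho (by simpa using hi)
  obtain ⟨l, hl, hlf⟩ := hf.exists_maxFace Window.interior_rev_nonempty
  rw [hlf] at hq
  exact lt_irrefl _ (lt_of_mem_interior hl hq.2 hqi)

theorem isClopen_cut {H : W.hyperplanes} {v : ℝ} (hv : v ∈ cutValues S o H) {s : SignType}
    (hs : s ≠ 0) : IsClopen (cut S W (levelSide o H v s)) := by
  obtain ⟨f, hf, γ, rfl, rfl⟩ := hv
  rw [← vadd_affSide]
  exact hW.2 f hf γ s hs

theorem isClopen_above {H : W.hyperplanes} {v : ℝ} (hv : v ∈ cutValues S o H) :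
    IsClopen {L : Internal S W | Above o L H v} := isClopen_cut hW hv (by decide)

theorem above_nonsingularModel {H : W.hyperplanes} {v : ℝ} (hv : v ∈ cutValues S o H)
    (w : NS S W) : Above o (nonsingularModel S W w) H v ↔ v < o.form H w := by
  constructor
  · intro h
    have := le_form_param_of_mem_cut h
    rw [param_nonsingularModel] at this
    exact lt_of_le_of_ne this (form_ne_of_mem_NS hW w.2 hv).symm
  · intro h
    exact nonsingularModel_mem_cut w (sign_pos (sub_pos.2 h))

/-- No nonsingular vector lies on the level, so the two half spaces are complementary on a dense
set; both cuts are clopen. -/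
theorem not_above_iff {H : W.hyperplanes} {v : ℝ} (hv : v ∈ cutValues S o H)
    (L : Internal S W) : ¬Above o L H v ↔ L ∈ cut S W (levelSide o H v (-1)) := by
  refine dense_range_nonsingularModel.induction_on
    (p := fun L => ¬Above o L H v ↔ L ∈ cut S W (levelSide o H v (-1))) L
    (isClosed_setOf_iff (isClopen_above hW hv).compl (isClopen_cut hW hv (by decide))) ?_
  intro w
  rw [above_nonsingularModel hW hv, not_lt]
  constructor
  · intro h
    refine nonsingularModel_mem_cut w (sign_neg (sub_neg.2 ?_))
    exact lt_of_le_of_ne h (form_ne_of_mem_NS hW w.2 hv)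
  · intro h
    simpa using form_param_le_of_mem_cut h

theorem above_of_lt {H : W.hyperplanes} {v : ℝ} (hv : v ∈ cutValues S o H) {L : Internal S W}
    (h : v < o.form H (param S W L)) : Above o L H v := by
  by_contra hc
  exact not_le.2 h (form_param_le_of_mem_cut ((not_above_iff hW hv L).1 hc))

omit hW in
theorem not_above_of_lt {H : W.hyperplanes} {v : ℝ} {L : Internal S W}
    (h : o.form H (param S W L) < v) : ¬Above o L H v :=
  fun hc => not_le.2 h (le_form_param_of_mem_cut hc)

theorem above_translate {H : W.hyperplanes} {v : ℝ} (hv : v ∈ cutValues S o H) (γ : S.Gam)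
    (L : Internal S W) :
    Above o (translate S W γ L) H v ↔ Above o L H (v - o.form H (S.star γ)) := by
  refine dense_range_nonsingularModel.induction_on
    (p := fun L => Above o (translate S W γ L) H v ↔ Above o L H (v - o.form H (S.star γ))) L
    (isClosed_setOf_iff ((isClopen_above hW hv).preimage (continuous_translate S W γ))
      (isClopen_above hW (sub_star_mem_cutValues hv γ))) ?_
  intro w
  rw [translate_nonsingularModel, above_nonsingularModel hW hv,
    above_nonsingularModel hW (sub_star_mem_cutValues hv γ), map_add, sub_lt_iff_lt_add]

/-- For a nonsingular model set, membership of `γ` says that `w - γ*` is in `M`, off all facet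
hyperplanes, so `mem_rev_iff` applies. Both sides being clopen, density extends this to all `L`. -/
theorem mem_iff_above (L : Internal S W) (γ : S.Gam) :
    (γ : Eu d) ∈ L.1 ↔ ∀ f : {f // IsFacet W.rev f},
      (Above o L (facetHyperplane f.2) (o.form (facetHyperplane f.2) (S.star γ) +
        facetValue o f.2) ↔ facetSign o f.2 = 1) := by
  have hfin : Finite {f // IsFacet W.rev f} := finite_isFacet.to_subtype
  refine dense_range_nonsingularModel.induction_on
    (p := fun L : Internal S W => (γ : Eu d) ∈ L.1 ↔ ∀ f : {f // IsFacet W.rev f},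
      (Above o L (facetHyperplane f.2) (o.form (facetHyperplane f.2) (S.star γ) +
        facetValue o f.2) ↔ facetSign o f.2 = 1)) L
    (isClosed_setOf_iff (Internal.isClopen_mem γ) ?_) ?_
  · rw [Set.ofPred_forall]
    refine isClopen_iInter_of_finite fun f => ?_
    have := isClopen_above hW (mem_cutValues (o := o) f.2 γ)
    by_cases h : facetSign o f.2 = 1
    · simpa [h] using this
    · simp only [h, iff_false]
      exact this.compl
  · intro w
    have hne : ∀ f (hf : IsFacet W.rev f),
        o.form (facetHyperplane hf) (w - S.star γ) ≠ facetValue o hf := by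
      intro f hf h
      refine form_ne_of_mem_NS hW w.2 (mem_cutValues hf γ) ?_
      rw [← h, map_sub]
      ring
    rw [mem_nonsingularModel, ← neg_sub, ← W.mem_rev, mem_rev_iff o hne, Subtype.forall]
    refine forall_congr' fun f => forall_congr' fun hf => ?_
    rw [above_nonsingularModel hW (mem_cutValues hf γ), mem_affSide]
    have h1 := facetSign_ne_zero o hf
    have h2 := hne f hf
    rw [map_sub (o.form _)] at h2 ⊢
    rw [← sub_pos, ← sign_eq_one_iff, ← sub_sub]
    have h3 : SignType.sign (o.form (facetHyperplane hf) (w : Eu n) -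
        o.form (facetHyperplane hf) (S.star γ) - facetValue o hf) ≠ 0 := by
      rw [Ne, sign_eq_zero_iff, sub_eq_zero]
      exact h2
    -- Two nonzero signs agree as soon as they equal `1` simultaneously.
    revert h1 h3
    generalize facetSign o hf = a
    generalize SignType.sign (o.form (facetHyperplane hf) (w : Eu n) -
        o.form (facetHyperplane hf) (S.star γ) - facetValue o hf) = b
    revert a b
    decide

theorem Internal.ext_above {L L' : Internal S W}
    (h : ∀ H, ∀ v ∈ cutValues S o H, (Above o L H v ↔ Above o L' H v)) : L = L' := by
  refine Internal.ext_gam fun γ => ?_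
  rw [mem_iff_above hW, mem_iff_above hW]
  exact forall_congr' fun f => by rw [h _ _ (mem_cutValues f.2 γ)]

/-- The internal system carries the topology generated by the half spaces. -/
theorem Internal.tendsto_iff_above {ι : Type*} {l : Filter ι} {F : ι → Internal S W}
    {L : Internal S W} : Tendsto F l (𝓝 L) ↔
      ∀ H, ∀ v ∈ cutValues S o H, ∀ᶠ i in l, (Above o (F i) H v ↔ Above o L H v) := by
  constructor
  · intro h H v hv
    have hcl := isClopen_above hW hv
    by_cases hL : Above o L H v
    · filter_upwards [h.eventually (hcl.isOpen.mem_nhds hL)] with i hi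
      exact iff_of_true hi hL
    · filter_upwards [h.eventually (hcl.compl.isOpen.mem_nhds hL)] with i hi
      exact iff_of_false hi hL
  · intro h
    have hfin : Finite {f // IsFacet W.rev f} := finite_isFacet.to_subtype
    refine Internal.tendsto_iff.2 fun γ => ?_
    filter_upwards [eventually_all.2 fun f : {f // IsFacet W.rev f} =>
      h _ _ (mem_cutValues f.2 γ)] with i hi
    rw [mem_iff_above hW, mem_iff_above hW]
    exact forall_congr' fun f => by rw [hi f]

/-- There are point patterns over every vector, in every generic direction. -/
theorem exists_param_eq (w : Eu n) {x : Eu n} (hx : ∀ H, o.form H x ≠ 0) :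
    ∃ L : Internal S W, param S W L = w ∧ ∀ H, o.form H w ∈ cutValues S o H →
      (Above o L H (o.form H w) ↔ 0 < o.form H x) := by
  have := W.finite_hyperplanes
  let O : Set (Eu n) := {y | ∀ H, 0 < o.form H x * o.form H (y - w)}
  have hO : IsOpen O := by
    have : O = ⋂ H, {y | 0 < o.form H x * o.form H (y - w)} := by ext; simp [O]
    rw [this]
    refine isOpen_iInter_of_finite fun H => isOpen_lt continuous_const ?_
    exact continuous_const.mul ((o.form H).continuous_of_finiteDimensional.comp (by fun_prop))
  have hw : w ∈ closure O := by
    have ht : Tendsto (fun c : ℝ => w + c • x) (𝓝[>] 0) (𝓝 w) := by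
      have : Continuous fun c : ℝ => w + c • x := by fun_prop
      simpa using (this.tendsto 0).mono_left nhdsWithin_le_nhds
    refine mem_closure_of_tendsto ht ?_
    filter_upwards [self_mem_nhdsWithin] with c hc H
    have hc : 0 < c := hc
    have := mul_self_pos.2 (hx H)
    rw [add_sub_cancel_left, map_smul, smul_eq_mul]
    nlinarith [mul_pos hc this]
  have hw' : w ∈ closure (O ∩ NS S W) :=
    closure_minimal ((dense_NS S W).open_subset_closure_inter hO) isClosed_closure hw
  -- Along nonsingular vectors in the chamber `O` at `w` the bits at levels through `w` are
  -- constant, so a limit pattern inherits them.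
  obtain ⟨y, hy, hlim⟩ := mem_closure_iff_seq_limit.1 hw'
  have hle : (Ultrafilter.of (atTop : Filter ℕ) : Filter ℕ) ≤ atTop := Ultrafilter.of_le _
  obtain ⟨L, hL, hp⟩ := Internal.exists_tendsto (Ultrafilter.of atTop)
    (fun k => nonsingularModel S W ⟨y k, (hy k).2⟩) (w := w) (by
      simpa using hlim.mono_left hle)
  refine ⟨L, hp, fun H hH => ?_⟩
  obtain ⟨k, hk⟩ := ((Internal.tendsto_iff_above hW).1 hL H _ hH).exists
  rw [← hk, above_nonsingularModel hW hH]
  have h1 := (hy k).1 H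
  rw [map_sub] at h1
  constructor
  · intro h
    exact pos_of_mul_pos_left h1 (by linarith)
  · intro h
    linarith [pos_of_mul_pos_right h1 h.le]

end Signs
-- Vector and cone type of an element of the Ellis semigroup
section Ellis

variable {n d : ℕ} {S : CutProject n d} {W : Window n} {o : W.Sides}

@[simp]
theorem Ellis.mul_apply (g h : Ellis S W) (L : Internal S W) : (g * h).1 L = g.1 (h.1 L) := rfl

theorem Ellis.tendsto_iff {ι : Type*} {l : Filter ι} {F : ι → Ellis S W} {g : Ellis S W} :
    Tendsto F l (𝓝 g) ↔ ∀ L, Tendsto (fun i => (F i).1 L) l (𝓝 (g.1 L)) :=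
  (Topology.IsInducing.subtypeVal.tendsto_nhds_iff (f := F) (y := g)).trans tendsto_pi_nhds

/-- The translations along the filter `u` converge to `g`. -/
def Approaches (u : Filter S.Gam) (g : Ellis S W) : Prop :=
  ∀ L, Tendsto (fun γ => translate S W γ L) u (𝓝 (g.1 L))

theorem mem_ellisCut_iff {g : Ellis S W} {A : Set (Eu n)} :
    g ∈ ellisCut S W A ↔
      ∃ u : Ultrafilter S.Gam, Approaches (u : Filter S.Gam) g ∧
        ∀ᶠ γ in (u : Filter S.Gam), S.star γ ∈ A := by
  let m : S.Gam → Ellis S W := fun γ => ⟨translate S W γ, subset_closure (mem_range_self γ)⟩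
  have hset : {g : Ellis S W | ∃ γ : S.Gam, S.star γ ∈ A ∧ g.1 = translate S W γ} =
      m '' {γ | S.star γ ∈ A} := by
    ext g
    constructor
    · rintro ⟨γ, hγ, e⟩
      exact ⟨γ, hγ, Subtype.ext e.symm⟩
    · rintro ⟨γ, hγ, rfl⟩
      exact ⟨γ, hγ, rfl⟩
  rw [ellisCut, hset]
  constructor
  · intro h
    obtain ⟨v, hv, hvg⟩ := mem_closure_iff_ultrafilter.1 h
    refine ⟨Ultrafilter.ofComapInfPrincipal hv, ?_, Ultrafilter.ofComapInfPrincipal_mem hv⟩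
    have ht : Tendsto m (Ultrafilter.ofComapInfPrincipal hv) (𝓝 g) := by
      have := Ultrafilter.ofComapInfPrincipal_eq_of_map hv
      rw [Tendsto, ← Ultrafilter.coe_map, this]
      exact hvg
    exact Ellis.tendsto_iff.1 ht
  · rintro ⟨u, hu, hA⟩
    exact mem_closure_of_tendsto (Ellis.tendsto_iff.2 hu : Tendsto m u (𝓝 g))
      (hA.mono fun γ hγ => ⟨γ, hγ, rfl⟩)

theorem Ellis.exists_approaches (g : Ellis S W) :
    ∃ u : Ultrafilter S.Gam, Approaches (u : Filter S.Gam) g := by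
  obtain ⟨v, hv, hvg⟩ := mem_closure_iff_ultrafilter.1 g.2
  rw [← image_univ] at hv
  refine ⟨Ultrafilter.ofComapInfPrincipal hv, ?_⟩
  have ht : Tendsto (translate S W) (Ultrafilter.ofComapInfPrincipal hv) (𝓝 g.1) := by
    have := Ultrafilter.ofComapInfPrincipal_eq_of_map hv
    rw [Tendsto, ← Ultrafilter.coe_map, this]
    exact hvg
  exact tendsto_pi_nhds.1 ht

theorem Approaches.tendsto_param {u : Filter S.Gam} {g : Ellis S W} (hu : Approaches u g)
    (L : Internal S W) : Tendsto S.star u (𝓝 (param S W (g.1 L) - param S W L)) := by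
  have := ((continuous_param.tendsto _).comp (hu L)).sub_const (param S W L)
  simpa [Function.comp_def] using this

/-- The displacement of the parameter is the limit of `γ*` along an ultrafilter approaching `g`,
which does not involve the pattern. -/
theorem eq_vec_iff (g : Ellis S W) (v : Eu n) :
    (∀ L, param S W (g.1 L) = param S W L + v) ↔ v = vec S W g := by
  obtain ⟨u, hu⟩ := g.exists_approaches
  have hex : ∃ v, ∀ L, param S W (g.1 L) = param S W L + v := by
    have L₀ : Internal S W := Classical.arbitrary _
    refine ⟨param S W (g.1 L₀) - param S W L₀, fun L => ?_⟩
    rw [← tendsto_nhds_unique (hu.tendsto_param L) (hu.tendsto_param L₀)]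
    abel
  have hspec : ∀ L, param S W (g.1 L) = param S W L + vec S W g := Classical.epsilon_spec hex
  constructor
  · intro h
    have L₀ : Internal S W := Classical.arbitrary _
    exact add_left_cancel ((h L₀).symm.trans (hspec L₀))
  · rintro rfl
    exact hspec

@[simp]
theorem param_apply (g : Ellis S W) (L : Internal S W) :
    param S W (g.1 L) = param S W L + vec S W g := (eq_vec_iff g _).2 rfl L

theorem Approaches.tendsto_star {u : Filter S.Gam} {g : Ellis S W} (hu : Approaches u g) :
    Tendsto S.star u (𝓝 (vec S W g)) := by
  simpa using hu.tendsto_param (Classical.arbitrary _)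

theorem vec_mul (g h : Ellis S W) : vec S W (g * h) = vec S W g + vec S W h := by
  refine ((eq_vec_iff _ _).1 fun L => ?_).symm
  simp only [Ellis.mul_apply, param_apply]
  abel

theorem Ultrafilter.exists_eventually_eq {α β : Type*} [Finite β] (u : Ultrafilter α)
    (f : α → β) : ∃ b, ∀ᶠ a in (u : Filter α), f a = b := by
  obtain ⟨b, hb⟩ := (u.map f).eq_pure_of_finite
  refine ⟨b, ?_⟩
  have : {b} ∈ u.map f := by rw [hb]; exact mem_singleton b
  exact this

variable (hW : AlmostCanonical S W o)
include hW

/-- The bit of the translate by `γ` at a level through `w_L + w_g` is the bit of `L` at a level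
differing from that of `w_L` by the form at `γ* - w_g`. It is forced by `w_L` unless this difference
vanishes. -/
theorem Approaches.above_iff {u : Ultrafilter S.Gam} {g : Ellis S W}
    (hu : Approaches (u : Filter S.Gam) g) {H : W.hyperplanes} {s : SignType}
    (hs : ∀ᶠ γ in (u : Filter S.Gam), SignType.sign (o.form H (S.star γ - vec S W g)) = s)
    {L : Internal S W} (hL : o.form H (param S W L + vec S W g) ∈ cutValues S o H) :
    (s = 0 → o.form H (param S W L) ∈ cutValues S o H) ∧
    (Above o (g.1 L) H (o.form H (param S W L + vec S W g)) ↔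
      s = 1 ∨ s = 0 ∧ Above o L H (o.form H (param S W L))) := by
  obtain ⟨γ, hγ, hγ'⟩ := (hs.and ((Internal.tendsto_iff_above hW).1 (hu L) H _ hL)).exists
  rw [above_translate hW hL] at hγ'
  have hcut := sub_star_mem_cutValues hL γ
  have e : o.form H (param S W L + vec S W g) - o.form H (S.star γ) =
      o.form H (param S W L) - o.form H (S.star γ - vec S W g) := by
    rw [map_add, map_sub]; ring
  rw [e] at hcut hγ'
  rcases lt_trichotomy (o.form H (S.star γ - vec S W g)) 0 with h | h | h
  · rw [sign_neg h] at hγ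
    subst hγ
    refine ⟨fun h => absurd h (by decide), ?_⟩
    rw [← hγ']
    refine iff_of_false (not_above_of_lt (by linarith)) ?_
    rintro (h | ⟨h, -⟩) <;> exact absurd h (by decide)
  · rw [h, sub_zero] at hcut hγ'
    rw [h, sign_zero] at hγ
    subst hγ
    exact ⟨fun _ => hcut, by simpa using hγ'.symm⟩
  · rw [sign_pos h] at hγ
    subst hγ
    refine ⟨fun h => absurd h (by decide), ?_⟩
    rw [← hγ']
    exact iff_of_true (above_of_lt hW hcut (by linarith)) (Or.inl rfl)

/-- A pair of point patterns detecting the sign of an element of the Ellis semigroup at `H`. -/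
theorem exists_detecting_pair (H : W.hyperplanes) (w : Eu n) :
    ∃ (L L' : Internal S W) (v : ℝ), v ∈ cutValues S o H ∧ o.form H (param S W L + w) = v ∧
      o.form H (param S W L' + w) = v ∧
      (o.form H (param S W L) ∈ cutValues S o H → Above o L H (o.form H (param S W L))) ∧
      (o.form H (param S W L') ∈ cutValues S o H → ¬Above o L' H (o.form H (param S W L'))) ∧
      ∀ (u : Ultrafilter S.Gam) (g : Ellis S W) (s : SignType),
        Approaches (u : Filter S.Gam) g → o.form H (vec S W g) = o.form H w →
        (∀ᶠ γ in (u : Filter S.Gam), SignType.sign (o.form H (S.star γ - vec S W g)) = s) →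
        (Above o (g.1 L) H v ↔ s ≠ -1) ∧ (Above o (g.1 L') H v ↔ s = 1) := by
  have := W.finite_hyperplanes
  -- A generic `x` and its opposite give two patterns over the same vector with opposite bits. That
  -- vector `z - w` is placed so that adding `w` reaches a level in `cutValues`.
  obtain ⟨x, hx⟩ := Module.Dual.exists_forall_ne_zero_of_forall_exists o.form fun H =>
    DFunLike.ne_iff.1 (form_ne_zero (o := o) H)
  obtain ⟨x, hx, hxH⟩ : ∃ x, (∀ H, o.form H x ≠ 0) ∧ 0 < o.form H x := by
    rcases lt_or_gt_of_ne (hx H) with h | h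
    · exact ⟨-x, fun H' => by rw [map_neg]; exact neg_ne_zero.2 (hx H'), by
        rw [map_neg]; exact neg_pos.2 h⟩
    · exact ⟨x, hx, h⟩
  obtain ⟨v, hv⟩ := cutValues_nonempty (S := S) (o := o) H
  obtain ⟨z, hz⟩ := LinearMap.surjective (form_ne_zero (o := o) H) v
  obtain ⟨L, hL, hLH⟩ := exists_param_eq hW (z - w) hx
  obtain ⟨L', hL', hLH'⟩ := exists_param_eq hW (z - w) (x := -x) fun H' => by
    rw [map_neg]; exact neg_ne_zero.2 (hx H')
  refine ⟨L, L', v, hv, by rw [hL]; simpa using hz, by rw [hL']; simpa using hz, ?_, ?_, ?_⟩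
  · rw [hL]
    exact fun h => (hLH H h).2 hxH
  · rw [hL']
    exact fun h => (hLH' H h).not.2 (by rw [map_neg]; linarith)
  intro u g s hu hvec hs
  have e : ∀ M : Internal S W, param S W M = z - w →
      o.form H (param S W M + vec S W g) = v := by
    intro M hM
    rw [map_add, hM, hvec, ← map_add, sub_add_cancel, hz]
  have h1 := hu.above_iff hW hs (L := L) (by rw [e L hL]; exact hv)
  have h2 := hu.above_iff hW hs (L := L') (by rw [e L' hL']; exact hv)
  rw [e L hL, hL] at h1
  rw [e L' hL', hL'] at h2
  rw [h1.2, h2.2]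
  have h3 := fun h : s = 0 => (hLH H (h1.1 h)).2 hxH
  have h4 := fun h : s = 0 => (hLH' H (h1.1 h)).not.2 (by rw [map_neg]; linarith)
  revert h3 h4
  cases s <;> simp_all

/-- A sign exists because an ultrafilter makes a three-valued function constant. It is unique
because a detecting pair reads off whether it is `-1` and whether it is `1`. -/
theorem mem_ellisCut_side_iff (g : Ellis S W) (H : W.hyperplanes) (s : SignType) :
    g ∈ ellisCut S W (side o H s (vec S W g)) ↔ s = coneType S o g H := by
  obtain ⟨u, hu⟩ := g.exists_approaches
  obtain ⟨s₀, hs₀⟩ := Ultrafilter.exists_eventually_eq u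
    fun γ => SignType.sign (o.form H (S.star γ - vec S W g))
  have hmem : g ∈ ellisCut S W (side o H s₀ (vec S W g)) := mem_ellisCut_iff.2 ⟨u, hu, hs₀⟩
  have huniq : ∀ s s', g ∈ ellisCut S W (side o H s (vec S W g)) →
      g ∈ ellisCut S W (side o H s' (vec S W g)) → s = s' := by
    intro s s' hs hs'
    obtain ⟨u, hu, h⟩ := mem_ellisCut_iff.1 hs
    obtain ⟨u', hu', h'⟩ := mem_ellisCut_iff.1 hs'
    obtain ⟨L, L', v, -, -, -, -, -, key⟩ := exists_detecting_pair hW H (vec S W g)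
    obtain ⟨h1, h2⟩ := key u g s hu rfl h
    obtain ⟨h3, h4⟩ := key u' g s' hu' rfl h'
    have h5 := h1.symm.trans h3
    have h6 := h2.symm.trans h4
    clear * - h5 h6
    revert s s'
    decide
  have hspec : g ∈ ellisCut S W (side o H (coneType S o g H) (vec S W g)) :=
    Classical.epsilon_spec (p := fun s => g ∈ ellisCut S W (side o H s (vec S W g))) ⟨s₀, hmem⟩
  exact ⟨fun h => huniq _ _ h hspec, fun h => h ▸ hspec⟩

theorem Approaches.eventually_mem_coneSet {u : Ultrafilter S.Gam} {g : Ellis S W}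
    (hu : Approaches (u : Filter S.Gam) g) :
    ∀ᶠ γ in (u : Filter S.Gam), S.star γ - vec S W g ∈ coneSet o (coneType S o g) := by
  have := W.finite_hyperplanes
  refine eventually_all.2 fun H => ?_
  obtain ⟨s₀, hs₀⟩ := Ultrafilter.exists_eventually_eq u
    fun γ => SignType.sign (o.form H (S.star γ - vec S W g))
  rwa [← (mem_ellisCut_side_iff hW g H s₀).1 (mem_ellisCut_iff.2 ⟨u, hu, hs₀⟩)]

theorem above_apply (g : Ellis S W) {H : W.hyperplanes} {L : Internal S W}
    (hL : o.form H (param S W L + vec S W g) ∈ cutValues S o H) :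
    (coneType S o g H = 0 → o.form H (param S W L) ∈ cutValues S o H) ∧
    (Above o (g.1 L) H (o.form H (param S W L + vec S W g)) ↔
      coneType S o g H = 1 ∨ coneType S o g H = 0 ∧ Above o L H (o.form H (param S W L))) := by
  obtain ⟨u, hu⟩ := g.exists_approaches
  exact hu.above_iff hW ((hu.eventually_mem_coneSet hW).mono fun γ hγ => hγ H) hL

theorem exists_coneType_detecting_pair (H : W.hyperplanes) (w : Eu n) :
    ∃ (L L' : Internal S W) (v : ℝ), v ∈ cutValues S o H ∧ o.form H (param S W L + w) = v ∧
      o.form H (param S W L' + w) = v ∧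
      (o.form H (param S W L) ∈ cutValues S o H → Above o L H (o.form H (param S W L))) ∧
      (o.form H (param S W L') ∈ cutValues S o H → ¬Above o L' H (o.form H (param S W L'))) ∧
      ∀ (g : Ellis S W), o.form H (vec S W g) = o.form H w →
        (Above o (g.1 L) H v ↔ coneType S o g H ≠ -1) ∧
        (Above o (g.1 L') H v ↔ coneType S o g H = 1) := by
  obtain ⟨L, L', v, h1, h2, h3, k1, k2, h4⟩ := exists_detecting_pair hW H w
  refine ⟨L, L', v, h1, h2, h3, k1, k2, fun g hg => ?_⟩
  obtain ⟨u, hu⟩ := g.exists_approaches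
  exact h4 u g _ hu hg ((hu.eventually_mem_coneSet hW).mono fun γ hγ => hγ H)

omit hW in
theorem sign_eq_ite_of_iff {t a b : SignType} {p q : Prop}
    (h1 : t ≠ -1 ↔ a = 1 ∨ a = 0 ∧ (b = 1 ∨ b = 0 ∧ p))
    (h2 : t = 1 ↔ a = 1 ∨ a = 0 ∧ (b = 1 ∨ b = 0 ∧ q))
    (hp : a = 0 → b = 0 → p) (hq : a = 0 → b = 0 → ¬q) : t = if a = 0 then b else a := by
  cases t <;> cases a <;> cases b <;> simp_all

/-- A nonzero sign of `g` overrides everything; a zero sign passes on the bit produced by `h`. Both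
patterns of a detecting pair are followed through `h` and then `g`. -/
theorem coneType_mul (g h : Ellis S W) :
    coneType S o (g * h) = signMul (coneType S o g) (coneType S o h) := by
  funext H
  obtain ⟨L, L', v, hv, e, e', A, A', key⟩ := exists_coneType_detecting_pair hW H (vec S W (g * h))
  obtain ⟨k1, k2⟩ := key _ rfl
  have main : ∀ M : Internal S W, o.form H (param S W M + vec S W (g * h)) = v →
      (Above o ((g * h).1 M) H v ↔ coneType S o g H = 1 ∨ coneType S o g H = 0 ∧
        (coneType S o h H = 1 ∨ coneType S o h H = 0 ∧ Above o M H (o.form H (param S W M)))) ∧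
      (coneType S o g H = 0 → coneType S o h H = 0 →
        o.form H (param S W M) ∈ cutValues S o H) := by
    intro M hM
    have hM' : o.form H (param S W (h.1 M) + vec S W g) = v := by
      rw [← hM, vec_mul, param_apply]
      congr 1
      abel
    obtain ⟨a1, a2⟩ := above_apply hW g (L := h.1 M) (by rw [hM']; exact hv)
    rw [hM'] at a2
    refine ⟨a2.trans (or_congr_right (and_congr_right fun h0 => ?_)), fun h0 => ?_⟩
    · have a3 := a1 h0
      rw [param_apply] at a3 ⊢
      exact (above_apply hW h a3).2
    · have a3 := a1 h0
      rw [param_apply] at a3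
      exact (above_apply hW h a3).1
  obtain ⟨m1, m2⟩ := main L e
  obtain ⟨m3, m4⟩ := main L' e'
  rw [k1] at m1
  rw [k2] at m3
  exact sign_eq_ite_of_iff m1 m3 (fun x y => A (m2 x y)) fun x y => A' (m4 x y)

/-- The pairs approximated from `Γ*` within the cone of the type. -/
def Admissible (S : CutProject n d) (o : W.Sides) (t : W.hyperplanes → SignType)
    (w : Eu n) : Prop :=
  ∀ ε > 0, ∃ γ : S.Gam, S.star γ - w ∈ coneSet o t ∧ ‖S.star γ - w‖ < ε

theorem admissible_ellis (g : Ellis S W) : Admissible S o (coneType S o g) (vec S W g) := by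
  intro ε hε
  obtain ⟨u, hu⟩ := g.exists_approaches
  obtain ⟨γ, h1, h2⟩ := ((hu.eventually_mem_coneSet hW).and
    (Metric.tendsto_nhds.1 hu.tendsto_star ε hε)).exists
  exact ⟨γ, h1, by rwa [← dist_eq_norm]⟩

/-- An ultrafilter along approximants of `w` in the cone makes every orbit converge, by local
compactness of the internal system; the limit map has the required vector and type. -/
theorem exists_ellis {t : W.hyperplanes → SignType} {w : Eu n} (h : Admissible S o t w) :
    ∃ g : Ellis S W, vec S W g = w ∧ coneType S o g = t := by
  choose F hF hF' using fun k : ℕ => h (1 / (k + 1 : ℝ)) Nat.one_div_pos_of_nat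
  have hlim : Tendsto (fun k => S.star (F k)) atTop (𝓝 w) := by
    refine tendsto_iff_norm_sub_tendsto_zero.2 ?_
    exact squeeze_zero (fun _ => norm_nonneg _) (fun k => (hF' k).le)
      tendsto_one_div_add_atTop_nhds_zero_nat
  let u : Ultrafilter S.Gam := (Ultrafilter.of (atTop : Filter ℕ)).map F
  have hle : (Ultrafilter.of (atTop : Filter ℕ) : Filter ℕ) ≤ atTop := Ultrafilter.of_le _
  have hstar : Tendsto S.star u (𝓝 w) := by
    rw [Ultrafilter.coe_map, tendsto_map'_iff]
    exact hlim.mono_left hle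
  have hcone : ∀ᶠ γ in (u : Filter S.Gam), S.star γ - w ∈ coneSet o t := by
    rw [Ultrafilter.coe_map, eventually_map]
    exact Eventually.of_forall hF
  have hL : ∀ L : Internal S W, ∃ L', Tendsto (fun γ => translate S W γ L) u (𝓝 L') := by
    intro L
    obtain ⟨L', h', -⟩ := Internal.exists_tendsto u (fun γ => translate S W γ L)
      (w := param S W L + w) (by simpa using hstar.const_add (param S W L))
    exact ⟨L', h'⟩
  choose G hG using hL
  have hmem : G ∈ closure (range (translate S W)) :=
    mem_closure_of_tendsto (tendsto_pi_nhds.2 hG) (Eventually.of_forall fun γ => mem_range_self γ)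
  let g : Ellis S W := ⟨G, hmem⟩
  have hg : Approaches (u : Filter S.Gam) g := hG
  have hv : vec S W g = w := tendsto_nhds_unique hg.tendsto_star hstar
  refine ⟨g, hv, funext fun H => ?_⟩
  refine ((mem_ellisCut_side_iff hW g H (t H)).1 (mem_ellisCut_iff.2 ⟨u, hg, ?_⟩)).symm
  filter_upwards [hcone] with γ hγ
  rw [hv]
  exact hγ H

/-- The sign with which a small head of the cone of `t`, translated by `x`, meets `H`. -/
noncomputable def headSign (o : W.Sides) (x : Eu n) (t : W.hyperplanes → SignType) (H : W.hyperplanes) :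
    SignType :=
  if o.form H x = 0 then t H else SignType.sign (o.form H x)

theorem above_apply_eq {g g' : Ellis S W} {H : W.hyperplanes}
    (h : headSign o (vec S W g' - vec S W g) (coneType S o g') H = coneType S o g H)
    {L : Internal S W} (hL : o.form H (param S W L + vec S W g) ∈ cutValues S o H) :
    Above o (g'.1 L) H (o.form H (param S W L + vec S W g)) ↔
      Above o (g.1 L) H (o.form H (param S W L + vec S W g)) := by
  unfold headSign at h
  rw [map_sub] at h
  rw [(above_apply hW g hL).2]
  split_ifs at h with h0
  · have e : o.form H (param S W L + vec S W g) = o.form H (param S W L + vec S W g') := by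
      rw [map_add, map_add, sub_eq_zero.1 h0]
    rw [e] at hL ⊢
    rw [(above_apply hW g' hL).2, h]
  · rw [← h]
    rcases lt_or_gt_of_ne h0 with h1 | h1
    · rw [sign_neg h1]
      refine iff_of_false (not_above_of_lt ?_) (by simp)
      rw [param_apply, map_add, map_add]
      linarith
    · rw [sign_pos h1]
      refine iff_of_true (above_of_lt hW hL ?_) (Or.inl rfl)
      rw [param_apply, map_add, map_add]
      linarith

/-- Bits at levels not through the parameter of `g(L)` are controlled by the vectors, the others by
the head signs. Conversely, detecting pairs read the head signs off finitely many bits. -/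
theorem ellis_tendsto_iff {ι : Type*} {l : Filter ι} {F : ι → Ellis S W} {g : Ellis S W} :
    Tendsto F l (𝓝 g) ↔ Tendsto (fun i => vec S W (F i)) l (𝓝 (vec S W g)) ∧
      ∀ᶠ i in l, ∀ H,
        headSign o (vec S W (F i) - vec S W g) (coneType S o (F i)) H = coneType S o g H := by
  have := W.finite_hyperplanes
  constructor
  · intro h
    rw [Ellis.tendsto_iff] at h
    constructor
    · have L : Internal S W := Classical.arbitrary _
      have h1 := ((continuous_param.tendsto _).comp (h L)).sub_const (param S W L)
      simpa [Function.comp_def] using h1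
    · refine eventually_all.2 fun H => ?_
      obtain ⟨L, L', v, hv, e, e', -, -, key⟩ := exists_coneType_detecting_pair hW H (vec S W g)
      obtain ⟨k1, k2⟩ := key g rfl
      filter_upwards [(Internal.tendsto_iff_above hW).1 (h L) H v hv,
        (Internal.tendsto_iff_above hW).1 (h L') H v hv] with i h1 h2
      rw [k1] at h1
      rw [k2] at h2
      unfold headSign
      rw [map_sub]
      split_ifs with h0
      · obtain ⟨k3, k4⟩ := key (F i) (sub_eq_zero.1 h0)
        rw [k3] at h1
        rw [k4] at h2
        clear * - h1 h2
        revert h1 h2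
        generalize coneType S o (F i) H = a
        generalize coneType S o g H = b
        revert a b
        decide
      -- The vector of `F i` is off the hyperplane through that of `g`, so the images of the pair
      -- under `F i` have left the level `v` and their bits are forced.
      · rw [map_add] at e e'
        rcases lt_or_gt_of_ne h0 with h3 | h3
        · have := not_above_of_lt (L := (F i).1 L) (H := H) (v := v) (o := o)
            (by rw [param_apply, map_add]; linarith)
          rw [sign_neg h3]
          by_contra hc
          exact this (h1.2 (Ne.symm hc))
        · have := above_of_lt hW hv (L := (F i).1 L')
            (by rw [param_apply, map_add]; linarith)
          rw [sign_pos h3, h2.1 this]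
  · rintro ⟨hv, hs⟩
    refine Ellis.tendsto_iff.2 fun L => (Internal.tendsto_iff_above hW).2 fun H v hcut => ?_
    have ht : Tendsto (fun i => o.form H (param S W ((F i).1 L))) l
        (𝓝 (o.form H (param S W (g.1 L)))) := by
      simp only [param_apply]
      exact ((o.form H).continuous_of_finiteDimensional.tendsto _).comp (hv.const_add _)
    rcases lt_trichotomy (o.form H (param S W (g.1 L))) v with h | h | h
    · filter_upwards [ht.eventually (gt_mem_nhds h)] with i hi
      exact iff_of_false (not_above_of_lt hi) (not_above_of_lt h)
    · filter_upwards [hs] with i hi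
      rw [← h, param_apply] at hcut ⊢
      exact above_apply_eq hW (hi H) hcut
    · filter_upwards [ht.eventually (lt_mem_nhds h)] with i hi
      exact iff_of_true (above_of_lt hW hcut hi) (above_of_lt hW hcut h)

theorem ellis_ext {g g' : Ellis S W} (hv : vec S W g = vec S W g')
    (ht : coneType S o g = coneType S o g') : g = g' := by
  refine Subtype.ext (funext fun L => Internal.ext_above hW fun H v hcut => ?_)
  rcases lt_trichotomy (o.form H (param S W L + vec S W g)) v with h | h | h
  · exact iff_of_false (not_above_of_lt (by rwa [param_apply]))
      (not_above_of_lt (by rwa [param_apply, ← hv]))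
  · rw [← h] at hcut ⊢
    refine (above_apply_eq hW (g' := g') ?_ hcut).symm
    simp [headSign, hv, ht]
  · exact iff_of_true (above_of_lt hW hcut (by rwa [param_apply]))
      (above_of_lt hW hcut (by rwa [param_apply, ← hv]))

/-- By `ellis_tendsto_iff`, a neighbourhood filter is pulled back from `ℝⁿ` and cut down by a single
set. -/
theorem firstCountable_ellis : FirstCountableTopology (Ellis S W) := by
  refine ⟨fun g => ?_⟩
  have : 𝓝 g = comap (vec S W) (𝓝 (vec S W g)) ⊓ 𝓟 {g' | ∀ H,
      headSign o (vec S W g' - vec S W g) (coneType S o g') H = coneType S o g H} := by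
    refine le_antisymm ?_ ?_
    · obtain ⟨h1, h2⟩ := (ellis_tendsto_iff hW (F := id)).1 (tendsto_id (x := 𝓝 g))
      exact le_inf (tendsto_iff_comap.1 h1) (le_principal_iff.2 h2)
    · refine tendsto_id'.1 ((ellis_tendsto_iff hW (F := id)).2 ⟨?_, ?_⟩)
      · exact tendsto_comap.mono_left inf_le_left
      · exact mem_inf_of_right (mem_principal_self _)
  rw [this]
  infer_instance

end Ellis
-- Subgroups of a Euclidean space
section Subgroup

variable {E : Type*} [NormedAddCommGroup E] [InnerProductSpace ℝ E]

/-- The largest linear subspace contained in the closure of a subgroup. -/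
def denseSpace (Z : AddSubgroup E) : Submodule ℝ E where
  carrier := {v | ∀ t : ℝ, t • v ∈ Z.topologicalClosure}
  zero_mem' := fun t => by simp
  add_mem' := fun {v w} hv hw t => by
    rw [smul_add]
    exact Z.topologicalClosure.add_mem (hv t) (hw t)
  smul_mem' := fun c v hv t => by
    rw [smul_smul]
    exact hv (t * c)

theorem denseSpace_subset (Z : AddSubgroup E) : (denseSpace Z : Set E) ⊆ closure Z :=
  fun v hv => by
    have h : (1 : ℝ) • v ∈ Z.topologicalClosure := hv 1
    rwa [one_smul] at h

variable [FiniteDimensional ℝ E]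

theorem starProjection_orthogonal_eq_zero_iff {V : Submodule ℝ E} {x : E} :
    Vᗮ.starProjection x = 0 ↔ x ∈ V := by
  rw [Submodule.starProjection_apply_eq_zero_iff, Submodule.orthogonal_orthogonal]

theorem sub_starProjection_orthogonal_mem (V : Submodule ℝ E) (x : E) :
    x - Vᗮ.starProjection x ∈ V := by
  rw [← starProjection_orthogonal_eq_zero_iff, map_sub, sub_eq_zero]
  exact (Submodule.starProjection_eq_self_iff.2 (Submodule.starProjection_apply_mem _ _)).symm

/-- Small elements of the closure of a subgroup lie in its largest linear subspace. -/
theorem exists_pos_forall_mem_denseSpace (Z : AddSubgroup E) :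
    ∃ ε > 0, ∀ z ∈ closure (Z : Set E), ‖z‖ < ε → z ∈ denseSpace Z := by
  by_contra! hcon
  let V := denseSpace Z
  have hVK : ∀ v ∈ V, v ∈ Z.topologicalClosure := denseSpace_subset Z
  choose z hzK hz hzV using fun k : ℕ => hcon (1 / (k + 1 : ℝ)) Nat.one_div_pos_of_nat
  -- Removing the components in `V` keeps the points in the closure and makes any limit direction
  -- orthogonal to `V`.
  let y : ℕ → E := fun k => Vᗮ.starProjection (z k)
  have hyK : ∀ k, y k ∈ Z.topologicalClosure := by
    intro k
    have := Z.topologicalClosure.sub_mem (hzK k)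
      (hVK _ (sub_starProjection_orthogonal_mem V (z k)))
    rwa [sub_sub_cancel] at this
  have hy0 : ∀ k, y k ≠ 0 := fun k h => hzV k (starProjection_orthogonal_eq_zero_iff.1 h)
  have hyn : Tendsto (fun k => ‖y k‖) atTop (𝓝 0) :=
    squeeze_zero (fun _ => norm_nonneg _)
      (fun k => (Submodule.norm_starProjection_apply_le _ _).trans (hz k).le)
      tendsto_one_div_add_atTop_nhds_zero_nat
  have hsph : ∀ k, ‖y k‖⁻¹ • y k ∈ Metric.sphere (0 : E) 1 := by
    intro k
    rw [mem_sphere_zero_iff_norm, norm_smul, norm_inv, norm_norm,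
      inv_mul_cancel₀ (norm_ne_zero_iff.2 (hy0 k))]
  obtain ⟨v, hv, φ, hφ, hlim⟩ := (isCompact_sphere (0 : E) 1).tendsto_subseq hsph
  have hvV : v ∈ V := by
    intro t
    -- Integer multiples of ever shorter vectors fill the whole limit line, the rounding error being
    -- at most `‖y‖`.
    have hk : Tendsto (fun k => ⌊t / ‖y (φ k)‖⌋ • y (φ k)) atTop (𝓝 (t • v)) := by
      have h1 : Tendsto (fun k => t • (‖y (φ k)‖⁻¹ • y (φ k))) atTop (𝓝 (t • v)) :=
        hlim.const_smul t
      have h2 : Tendsto (fun k => Int.fract (t / ‖y (φ k)‖) • y (φ k)) atTop (𝓝 0) := by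
        refine squeeze_zero_norm (fun k => ?_) (hyn.comp hφ.tendsto_atTop)
        rw [norm_smul, Real.norm_eq_abs, Int.abs_fract]
        exact mul_le_of_le_one_left (norm_nonneg _) (Int.fract_lt_one _).le
      have h3 := h1.sub h2
      rw [sub_zero] at h3
      refine h3.congr fun k => ?_
      rw [smul_smul, ← sub_smul, ← div_eq_mul_inv, Int.self_sub_fract, Int.cast_smul_eq_zsmul]
    exact Z.isClosed_topologicalClosure.mem_of_tendsto hk
      (Eventually.of_forall fun k => Z.topologicalClosure.zsmul_mem (hyK _) _)
  have hvo : v ∈ Vᗮ := by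
    refine (Submodule.isClosed_orthogonal V).mem_of_tendsto hlim (Eventually.of_forall fun k => ?_)
    exact Submodule.smul_mem _ _ (Submodule.starProjection_apply_mem _ _)
  have : v = 0 := by
    have := V.inner_right_of_mem_orthogonal hvV hvo
    exact inner_self_eq_zero.1 this
  rw [this] at hv
  simp at hv

/-- The subgroup is dense in the largest linear subspace of its closure. -/
theorem denseSpace_subset_closure_inter (Z : AddSubgroup E) :
    (denseSpace Z : Set E) ⊆ closure ((denseSpace Z : Set E) ∩ Z) := by
  obtain ⟨ε, hε, h⟩ := exists_pos_forall_mem_denseSpace Z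
  intro v hv
  rw [Metric.mem_closure_iff]
  intro r hr
  obtain ⟨z, hz, hd⟩ := Metric.mem_closure_iff.1 (denseSpace_subset Z hv) (min r ε)
    (lt_min hr hε)
  refine ⟨z, ⟨?_, hz⟩, hd.trans_le (min_le_left _ _)⟩
  have h1 : z - v ∈ denseSpace Z := by
    refine h _ (Z.topologicalClosure.sub_mem (subset_closure hz) (denseSpace_subset Z hv)) ?_
    rw [← dist_eq_norm, dist_comm]
    exact hd.trans_le (min_le_right _ _)
  simpa using (denseSpace Z).add_mem h1 hv

/-- A discrete subgroup has a linear section of any map defined on it, up to the choice of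
lifts on a basis. -/
theorem exists_linearMap_of_discrete (Q : Submodule ℤ E) [DiscreteTopology Q]
    {F : Type*} [AddCommGroup F] [Module ℝ F] (R : AddSubgroup (E × F))
    (hR : ∀ q ∈ Q, ∃ y, (q, y) ∈ R) (V : Submodule ℝ F) (hV : ∀ x y, (x, y) ∈ R → y ∈ V) :
    ∃ A : E →ₗ[ℝ] F, (∀ q ∈ Q, (q, A q) ∈ R) ∧ ∀ x, A x ∈ V := by
  -- In its real span `Q` is a full lattice, so a basis over `ℤ` is one over `ℝ`, and lifts chosen
  -- on it define a real linear map.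
  let f := (Submodule.span ℝ (Q : Set E)).subtype
  let L₀ := Q.comap (f.restrictScalars ℤ)
  have h_img : f '' L₀ = Q := by
    rw [← LinearMap.coe_restrictScalars ℤ f, ← Submodule.map_coe (f.restrictScalars ℤ),
      Submodule.map_comap_eq_self]
    exact fun x hx ↦ LinearMap.mem_range.mpr ⟨⟨x, Submodule.subset_span hx⟩, rfl⟩
  have : DiscreteTopology L₀ := by
    refine DiscreteTopology.preimage_of_continuous_injective (Q : Set E) ?_
      (Submodule.injective_subtype _)
    exact LinearMap.continuous_of_finiteDimensional f
  have : IsZLattice ℝ L₀ := ⟨by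
    rw [← (Submodule.map_injective_of_injective (Submodule.injective_subtype _)).eq_iff,
      Submodule.map_span, Submodule.map_top, Submodule.range_subtype, h_img]⟩
  have : Module.Free ℤ L₀ := ZLattice.module_free ℝ L₀
  let b := Module.Free.chooseBasis ℤ L₀
  let B := b.ofZLatticeBasis ℝ L₀
  have hB : ∀ i, f (B i) ∈ Q := fun i => by
    have : B i = b i := b.ofZLatticeBasis_apply ℝ L₀ i
    rw [this]
    exact (b i).2
  choose y hy using fun i => hR _ (hB i)
  let A₀ : Submodule.span ℝ (Q : Set E) →ₗ[ℝ] V :=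
    B.constr ℝ fun i => (⟨y i, hV _ _ (hy i)⟩ : V)
  obtain ⟨A, hA⟩ := A₀.exists_extend
  refine ⟨V.subtype ∘ₗ A, fun q hq => ?_, fun x => (A x).2⟩
  let q₀ : Submodule.span ℝ (Q : Set E) := ⟨q, Submodule.subset_span hq⟩
  have hAq : ∀ x : Submodule.span ℝ (Q : Set E), A x = A₀ x :=
    fun x => LinearMap.congr_fun hA x
  have key : ∀ x ∈ Submodule.span ℤ (Set.range B), ((x : E), ((A x : V) : F)) ∈ R := by
    intro x hx
    induction hx using Submodule.span_induction with
    | mem x hx =>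
      obtain ⟨i, rfl⟩ := hx
      rw [hAq, Module.Basis.constr_basis]
      exact hy i
    | zero =>
      rw [ZeroMemClass.coe_zero, map_zero, ZeroMemClass.coe_zero]
      exact R.zero_mem
    | add x x' _ _ h h' =>
      have := R.add_mem h h'
      simpa using this
    | smul a x _ h =>
      have := R.zsmul_mem h a
      simpa using this
  have hmem : q₀ ∈ Submodule.span ℤ (Set.range B) := by
    rw [b.ofZLatticeBasis_span ℝ]
    exact hq
  exact key q₀ hmem

end Subgroup

/-! ### The dense summand -/

section Decomposition

variable {n d : ℕ} {S : CutProject n d}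

/-- The elements of `Γ*` in the linear span of `C`. -/
def spanGroup (S : CutProject n d) (C : Set (Eu n)) : AddSubgroup (Eu n) :=
  (Submodule.span ℝ C).toAddSubgroup ⊓ S.GamStar

theorem denseSpace_spanGroup_le (C : Set (Eu n)) :
    denseSpace (spanGroup S C) ≤ Submodule.span ℝ C := fun _ hv =>
  closure_minimal (fun _ hx => hx.1) (Submodule.closed_of_finiteDimensional _)
    (denseSpace_subset _ hv)

/-- The projection of the group to `Vᗮ` is discrete. A linear map `A` with values in `V` lifts it
back into the group, and the graph of `A` over `⟨C⟩ ∩ Vᗮ` serves as `D`. -/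
theorem exists_isDecomposition (C : Set (Eu n)) :
    ∃ D, IsDecomposition S C (denseSpace (spanGroup S C)) D := by
  let Z := spanGroup S C
  let V := denseSpace Z
  let X := Submodule.span ℝ C
  have hVX : V ≤ X := denseSpace_spanGroup_le C
  let π := Vᗮ.starProjection
  have hπX : ∀ x ∈ X, π x ∈ X := by
    intro x hx
    have := X.sub_mem hx (hVX (sub_starProjection_orthogonal_mem V x))
    rwa [sub_sub_cancel] at this
  obtain ⟨ε, hε, hsmall⟩ := exists_pos_forall_mem_denseSpace Z
  -- `π z` is again in the closure of `Z`; if small, it lies in both `V` and `Vᗮ`.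
  have hgap : ∀ z ∈ Z, ‖π z‖ < ε → π z = 0 := by
    intro z hz hlt
    have h1 : π z ∈ Z.topologicalClosure := by
      have := Z.topologicalClosure.sub_mem (subset_closure hz)
        (denseSpace_subset Z (sub_starProjection_orthogonal_mem V z))
      rwa [sub_sub_cancel] at this
    have h2 : π z ∈ V := hsmall _ h1 hlt
    have h3 := V.inner_right_of_mem_orthogonal h2 (Submodule.starProjection_apply_mem Vᗮ z)
    exact inner_self_eq_zero.1 h3
  let Q : Submodule ℤ (Eu n) := AddSubgroup.toIntSubmodule (Z.map (π : Eu n →+ Eu n))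
  have hQ : ∀ q, q ∈ Q ↔ ∃ z ∈ Z, π z = q := fun q => Iff.rfl
  have hdisc : DiscreteTopology Q := by
    refine DiscreteTopology.of_forall_le_dist hε ?_
    rintro ⟨x, hx⟩ ⟨y, hy⟩ hne
    obtain ⟨z, hz, rfl⟩ := (hQ x).1 hx
    obtain ⟨z', hz', rfl⟩ := (hQ y).1 hy
    by_contra! hlt
    rw [Subtype.dist_eq, dist_eq_norm, ← map_sub] at hlt
    have := hgap _ (Z.sub_mem hz hz') hlt
    rw [map_sub, sub_eq_zero] at this
    exact hne (Subtype.ext this)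
  let R : AddSubgroup (Eu n × Eu n) :=
    { carrier := {p | p.2 ∈ V ∧ p.1 + p.2 ∈ Z}
      zero_mem' := ⟨V.zero_mem, by simp⟩
      add_mem' := fun {p q} hp hq => ⟨V.add_mem hp.1 hq.1, by
        have := Z.add_mem hp.2 hq.2
        rwa [add_add_add_comm] at this⟩
      neg_mem' := fun {p} hp => ⟨V.neg_mem hp.1, by
        have := Z.neg_mem hp.2
        rw [neg_add] at this
        exact this⟩ }
  obtain ⟨A, hA, hAV⟩ := exists_linearMap_of_discrete Q R (fun q hq => by
    obtain ⟨z, hz, rfl⟩ := (hQ q).1 hq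
    exact ⟨z - π z, sub_starProjection_orthogonal_mem V z, by simpa using hz⟩) V fun x y h => h.1
  have hπV : ∀ v ∈ V, π v = 0 := fun v hv => starProjection_orthogonal_eq_zero_iff.2 hv
  have hπo : ∀ y ∈ Vᗮ, π y = y := fun y hy => Submodule.starProjection_eq_self_iff.2 hy
  refine ⟨(X ⊓ Vᗮ).map (LinearMap.id + A), ?_, ?_, ?_, ?_, ?_⟩
  · refine le_antisymm (sup_le hVX ?_) fun x hx => ?_
    · rintro _ ⟨y, ⟨hyX, -⟩, rfl⟩
      exact X.add_mem hyX (hVX (hAV y))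
    · refine Submodule.mem_sup.2 ⟨x - π x - A (π x), ?_, π x + A (π x), ⟨π x, ⟨hπX x hx, ?_⟩, rfl⟩,
        by abel⟩
      · exact V.sub_mem (sub_starProjection_orthogonal_mem V x) (hAV _)
      · exact Submodule.starProjection_apply_mem _ _
  · rw [eq_bot_iff]
    rintro _ ⟨hv, y, ⟨-, hy⟩, rfl⟩
    have h1 := hπV _ hv
    simp only [LinearMap.add_apply, LinearMap.id_apply, map_add, hπV _ (hAV y), hπo y hy,
      add_zero] at h1
    simp [h1]
  · intro v hv
    refine closure_mono ?_ (denseSpace_subset_closure_inter Z hv)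
    exact fun x hx => ⟨hx.1, hx.2.2⟩
  · refine ⟨ε, hε, ?_⟩
    intro x hx hxG y hy hyG hne
    have hDX : ∀ w ∈ (X ⊓ Vᗮ).map (LinearMap.id + A), w ∈ X := by
      rintro _ ⟨y, ⟨hyX, -⟩, rfl⟩
      exact X.add_mem hyX (hVX (hAV y))
    have hz : x - y ∈ Z := Z.sub_mem ⟨hDX x hx, hxG⟩ ⟨hDX y hy, hyG⟩
    obtain ⟨u, ⟨-, hu⟩, e⟩ := Submodule.sub_mem _ hx hy
    by_contra! hlt
    rw [dist_eq_norm] at hlt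
    have h0 := hgap _ hz ((Submodule.norm_starProjection_apply_le _ _).trans_lt hlt)
    rw [← e] at h0
    simp only [LinearMap.add_apply, LinearMap.id_apply, map_add, hπV _ (hAV u), hπo u hu,
      add_zero] at h0
    rw [h0, map_zero] at e
    exact hne (sub_eq_zero.1 e.symm)
  · refine le_antisymm ?_ (sup_le ?_ ?_)
    · intro z hz
      have hz : z ∈ Z := hz
      have hq : π z ∈ Q := (hQ _).2 ⟨z, hz, rfl⟩
      have hR : π z + A (π z) ∈ Z := (hA _ hq).2
      refine AddSubgroup.mem_sup.2 ⟨z - (π z + A (π z)), ⟨?_, (Z.sub_mem hz hR).2⟩,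
        π z + A (π z), ⟨⟨π z, ⟨hπX z hz.1, Submodule.starProjection_apply_mem _ _⟩, rfl⟩, hR.2⟩,
        sub_add_cancel _ _⟩
      rw [← sub_sub]
      exact V.sub_mem (sub_starProjection_orthogonal_mem V z) (hAV _)
    · exact fun x hx => ⟨hVX hx.1, hx.2⟩
    · rintro _ ⟨⟨y, ⟨hyX, -⟩, rfl⟩, hG⟩
      exact ⟨X.add_mem hyX (hVX (hAV y)), hG⟩

/-- Modulo `V` the group is the projection of the uniformly discrete `D ∩ Γ*`, so its nonzero
projections are bounded below. A line in the closure but not in `V` would violate this. -/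
theorem IsDecomposition.eq_denseSpace {C : Set (Eu n)} {V D : Submodule ℝ (Eu n)}
    (h : IsDecomposition S C V D) : V = denseSpace (spanGroup S C) := by
  obtain ⟨h1, h2, h3, ⟨r, hr, h4⟩, h5⟩ := h
  have hVX : V ≤ Submodule.span ℝ C := h1 ▸ le_sup_left
  refine le_antisymm (fun v hv t => ?_) fun v hv => ?_
  · refine closure_mono ?_ (h3 (V.smul_mem t hv))
    exact fun x hx => ⟨hVX hx.1, hx.2⟩
  · let π := Vᗮ.starProjection
    have hinj : LinearMap.ker (π.toLinearMap ∘ₗ D.subtype) = ⊥ := by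
      rw [eq_bot_iff]
      intro x hx
      have hxV : (x : Eu n) ∈ V := starProjection_orthogonal_eq_zero_iff.1 hx
      have : (x : Eu n) ∈ V ⊓ D := ⟨hxV, x.2⟩
      rw [h2] at this
      exact Subtype.ext this
    obtain ⟨K, hK0, hK⟩ := LinearMap.exists_antilipschitzWith _ hinj
    have hgap : ∀ z ∈ spanGroup S C, π z = 0 ∨ r / K ≤ ‖π z‖ := by
      intro z hz
      have hz' : z ∈ (V.toAddSubgroup ⊓ S.GamStar) ⊔ (D.toAddSubgroup ⊓ S.GamStar) := h5 ▸ hz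
      obtain ⟨a, ha, b, hb, rfl⟩ := AddSubgroup.mem_sup.1 hz'
      rw [map_add, show π a = 0 from starProjection_orthogonal_eq_zero_iff.2 ha.1, zero_add]
      by_cases hb0 : b = 0
      · exact Or.inl (by rw [hb0, map_zero])
      · right
        have h6 := h4 b hb.1 hb.2 0 D.zero_mem S.GamStar.zero_mem hb0
        have h7 := hK.le_mul_dist ⟨b, hb.1⟩ 0
        rw [Subtype.dist_eq, map_zero, dist_zero_right] at h7
        have h8 : r ≤ K * ‖π b‖ := h6.trans h7
        rwa [div_le_iff₀' (by exact_mod_cast hK0)]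
    have hclosed : IsClosed {z : Eu n | π z = 0 ∨ r / K ≤ ‖π z‖} :=
      (isClosed_eq π.continuous continuous_const).union
        (isClosed_le continuous_const π.continuous.norm)
    rw [← starProjection_orthogonal_eq_zero_iff]
    by_contra h0
    have hpos : 0 < ‖π v‖ := norm_pos_iff.2 h0
    have hrK : 0 < r / K := by positivity
    -- The multiple of `v` whose projection has half the norm of the gap.
    have h9 : π ((r / K / (2 * ‖π v‖)) • v) = 0 ∨ r / K ≤ ‖π ((r / K / (2 * ‖π v‖)) • v)‖ :=
      closure_minimal (t := {z : Eu n | π z = 0 ∨ r / K ≤ ‖π z‖}) hgap hclosed (hv _)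
    rw [map_smul, smul_eq_zero, norm_smul, Real.norm_of_nonneg (by positivity)] at h9
    have e : r / K / (2 * ‖π v‖) * ‖π v‖ = r / K / 2 := by field_simp
    rw [e] at h9
    rcases h9 with (h9 | h9) | h9
    · have : 0 < r / K / (2 * ‖π v‖) := by positivity
      exact this.ne' h9
    · exact h0 h9
    · linarith

theorem denseSummand_eq (C : Set (Eu n)) : denseSummand S C = denseSpace (spanGroup S C) := by
  have : {V | ∃ D, IsDecomposition S C V D} = {denseSpace (spanGroup S C)} := by
    ext V
    constructor
    · rintro ⟨D, h⟩
      exact h.eq_denseSpace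
    · rintro rfl
      exact exists_isDecomposition C
  rw [denseSummand, this, sSup_singleton]

end Decomposition
-- Admissible pairs and heads of plain cones
section Cones

variable {n d : ℕ} {S : CutProject n d} {W : Window n} {o : W.Sides}

theorem sign_form_add_eventually (H : W.hyperplanes) (x : Eu n) :
    ∀ᶠ y in 𝓝 (0 : Eu n), o.form H x ≠ 0 →
      SignType.sign (o.form H (x + y)) = SignType.sign (o.form H x) := by
  have hc : Continuous fun y => o.form H (x + y) :=
    (o.form H).continuous_of_finiteDimensional.comp (by fun_prop)
  have ht : Tendsto (fun y => o.form H (x + y)) (𝓝 0) (𝓝 (o.form H x)) := by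
    simpa using hc.tendsto 0
  rcases lt_trichotomy (o.form H x) 0 with h | h | h
  · filter_upwards [ht.eventually (gt_mem_nhds h)] with y hy _
    rw [sign_neg hy, sign_neg h]
  · exact Eventually.of_forall fun y hy => absurd h hy
  · filter_upwards [ht.eventually (lt_mem_nhds h)] with y hy _
    rw [sign_pos hy, sign_pos h]

/-- A cone is open in its linear span. -/
theorem add_mem_coneSet_of_mem_span {t : W.hyperplanes → SignType} {x : Eu n}
    (hx : x ∈ coneSet o t) : ∀ᶠ y in 𝓝 (0 : Eu n), y ∈ Submodule.span ℝ (coneSet o t) →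
      x + y ∈ coneSet o t := by
  have := W.finite_hyperplanes
  filter_upwards [eventually_all.2 fun H => sign_form_add_eventually (o := o) H x] with y hy hys H
  by_cases h : o.form H x = 0
  · have ht : t H = 0 := by rw [← hx H, h, sign_zero]
    have hle : Submodule.span ℝ (coneSet o t) ≤ LinearMap.ker (o.form H) := by
      refine Submodule.span_le.2 fun z hz => ?_
      have := hz H
      rw [ht, sign_eq_zero_iff] at this
      exact this
    have hy0 : o.form H y = 0 := hle hys
    rw [map_add, h, hy0, add_zero, sign_zero, ht]
  · rw [hy H h, hx H]

/-- The difference of two approximants is a small element of `⟨C⟩ ∩ Γ*`, hence in the dense space;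
the second approximant then tends to `w`. -/
theorem exists_pos_sub_mem_denseSpace (S : CutProject n d) (t : W.hyperplanes → SignType) :
    ∃ ε > 0, ∀ w, Admissible S o t w → ∀ γ : S.Gam, S.star γ - w ∈ coneSet o t →
      ‖S.star γ - w‖ < ε → S.star γ - w ∈ denseSpace (spanGroup S (coneSet o t)) := by
  obtain ⟨ε, hε, h⟩ := exists_pos_forall_mem_denseSpace (spanGroup S (coneSet o t))
  refine ⟨ε, hε, fun w hw γ hγ hγε => ?_⟩
  have hcl := Submodule.closed_of_finiteDimensional (denseSpace (spanGroup S (coneSet o t)))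
  rw [← SetLike.mem_coe, ← hcl.closure_eq, Metric.mem_closure_iff]
  intro r hr
  obtain ⟨γ', h1, h2⟩ := hw (min r (ε - ‖S.star γ - w‖)) (lt_min hr (by linarith))
  refine ⟨S.star γ - S.star γ', h _ (subset_closure ⟨?_, ?_⟩) ?_, ?_⟩
  · have := Submodule.sub_mem _ (Submodule.subset_span (R := ℝ) hγ) (Submodule.subset_span h1)
    rwa [sub_sub_sub_cancel_right] at this
  · exact S.GamStar.sub_mem (S.star_mem γ) (S.star_mem γ')
  · have h3 := norm_sub_le (S.star γ - w) (S.star γ' - w)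
    rw [sub_sub_sub_cancel_right] at h3
    linarith [h2.trans_le (min_le_right _ _)]
  · rw [dist_eq_norm, sub_sub_sub_cancel_left]
    exact h2.trans_le (min_le_left _ _)

theorem plainCone_eq (t : FaceType o) :
    plainCone S t = coneSet o t.sgn ∩ denseSpace (spanGroup S (coneSet o t.sgn)) := by
  rw [plainCone, denseSummand_eq]
  rfl

/-- A group element close to `v + p` misses it by a small vector of the span, and the cone is open
in its span. -/
theorem exists_star_sub_mem {t : W.hyperplanes → SignType} {v p g : Eu n}
    (hv : v ∈ denseSpace (spanGroup S (coneSet o t))) (hg : g ∈ S.GamStar)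
    (hp : p ∈ coneSet o t) (hpV : p ∈ denseSpace (spanGroup S (coneSet o t))) {r : ℝ}
    (hr : 0 < r) :
    ∃ γ : S.Gam, S.star γ - (v + g) ∈ coneSet o t ∧ ‖S.star γ - (v + g) - p‖ < r := by
  obtain ⟨ρ, hρ, hball⟩ := Metric.eventually_nhds_iff.1 (add_mem_coneSet_of_mem_span hp)
  have hvp := Submodule.add_mem _ hv hpV
  obtain ⟨z, hz, hd⟩ := Metric.mem_closure_iff.1 (denseSpace_subset _ hvp) (min r ρ)
    (lt_min hr hρ)
  obtain ⟨γ, hγ⟩ := S.exists_star_eq (S.GamStar.add_mem hz.2 hg)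
  have e : S.star γ - (v + g) = p + (z - (v + p)) := by rw [hγ]; abel
  rw [dist_comm] at hd
  refine ⟨γ, ?_, ?_⟩
  · rw [e]
    refine hball ?_ ?_
    · rw [dist_zero_right, ← dist_eq_norm]
      exact hd.trans_le (min_le_right _ _)
    · exact Submodule.sub_mem _ hz.1 (denseSpace_spanGroup_le _ hvp)
  · rw [e, add_sub_cancel_left, ← dist_eq_norm]
    exact hd.trans_le (min_le_left _ _)

theorem Admissible.exists_mem_plainCone {t : FaceType o} {w : Eu n}
    (h : Admissible S o t.sgn w) : ∃ γ : S.Gam, S.star γ - w ∈ plainCone S t := by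
  obtain ⟨ε, hε, hV⟩ := exists_pos_sub_mem_denseSpace (o := o) S t.sgn
  obtain ⟨γ, h1, h2⟩ := h ε hε
  exact ⟨γ, by rw [plainCone_eq]; exact ⟨h1, hV w h γ h1 h2⟩⟩

/-- Subtracting from one approximant a second, much closer one stays in the cone and removes `w`. -/
theorem Admissible.zero_mem_closure {t : W.hyperplanes → SignType} {w : Eu n}
    (h : Admissible S o t w) :
    (0 : Eu n) ∈ closure (coneSet o t ∩ (S.GamStar : Set (Eu n))) := by
  rw [Metric.mem_closure_iff]
  intro ε hε
  obtain ⟨γ, h1, h2⟩ := h (ε / 2) (half_pos hε)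
  obtain ⟨ρ, hρ, hball⟩ := Metric.eventually_nhds_iff.1 (add_mem_coneSet_of_mem_span h1)
  obtain ⟨γ', h3, h4⟩ := h (min ρ (ε / 2)) (lt_min hρ (half_pos hε))
  have e : S.star γ - S.star γ' = S.star γ - w + -(S.star γ' - w) := by abel
  refine ⟨S.star γ - S.star γ', ⟨?_, S.GamStar.sub_mem (S.star_mem γ) (S.star_mem γ')⟩, ?_⟩
  · rw [e]
    refine hball ?_ (Submodule.neg_mem _ (Submodule.subset_span h3))
    rw [dist_zero_right, norm_neg]
    exact h4.trans_le (min_le_left _ _)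
  · rw [dist_zero_left, e]
    have := norm_add_le (S.star γ - w) (-(S.star γ' - w))
    rw [norm_neg] at this
    linarith [h4.trans_le (min_le_right _ _)]

theorem plainCone_smul_mem {t : FaceType o} {x : Eu n} (hx : x ∈ plainCone S t) {c : ℝ}
    (hc : 0 < c) : c • x ∈ plainCone S t :=
  ⟨smul_mem_coneSet o hx.1 hc, Submodule.smul_mem _ _ hx.2⟩

theorem tendsto_smul_nhdsGT_zero (x : Eu n) :
    Tendsto (fun c : ℝ => c • x) (𝓝[>] 0) (𝓝 0) := by
  have : Continuous fun c : ℝ => c • x := by fun_prop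
  simpa using (this.tendsto 0).mono_left nhdsWithin_le_nhds

theorem plainCone_nonempty {t : FaceType o} (ht : t ∈ nontrivialFaces S o) :
    (plainCone S t).Nonempty := by
  obtain ⟨ε, hε, h⟩ := exists_pos_forall_mem_denseSpace (spanGroup S (coneSet o t.sgn))
  have ht : (0 : Eu n) ∈ closure (coneSet o t.sgn ∩ (S.GamStar : Set (Eu n))) := ht
  obtain ⟨z, ⟨hz, hzG⟩, hd⟩ := Metric.mem_closure_iff.1 ht ε hε
  rw [plainCone_eq]
  exact ⟨z, hz, h z (subset_closure ⟨Submodule.subset_span hz, hzG⟩) (by simpa using hd)⟩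

/-- A close approximant differs from `w` by a vector of the plain cone. Conversely, density in `V`
provides approximants near a short vector of that cone. -/
theorem admissible_iff {t : FaceType o} {w : Eu n} :
    Admissible S o t.sgn w ↔ t ∈ nontrivialFaces S o ∧
      w ∈ (Submodule.span ℝ (plainCone S t) : Set (Eu n)) + (S.GamStar : Set (Eu n)) := by
  constructor
  · intro h
    obtain ⟨γ, hγ⟩ := h.exists_mem_plainCone
    refine ⟨h.zero_mem_closure, w - S.star γ, ?_, S.star γ, S.star_mem γ, sub_add_cancel _ _⟩
    rw [← neg_sub]
    exact Submodule.neg_mem _ (Submodule.subset_span hγ)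
  · rintro ⟨ht, v, hv, g, hg, rfl⟩ ε hε
    obtain ⟨x, hx⟩ := plainCone_nonempty ht
    have hb := (tendsto_smul_nhdsGT_zero x).eventually (Metric.ball_mem_nhds 0 (half_pos hε))
    obtain ⟨c, hc, hc0⟩ := (hb.and self_mem_nhdsWithin).exists
    have hp := plainCone_smul_mem hx hc0
    rw [plainCone_eq] at hp hv
    have hv' := Submodule.span_le.2 inter_subset_right hv
    obtain ⟨γ, h1, h2⟩ := exists_star_sub_mem hv' hg hp.1 hp.2 (half_pos hε)
    refine ⟨γ, h1, ?_⟩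
    rw [dist_zero_right] at hc
    have := norm_add_le (S.star γ - (v + g) - c • x) (c • x)
    rw [sub_add_cancel] at this
    change ‖S.star γ - (v + g)‖ < ε
    linarith

theorem mem_plainHead {t : FaceType o} {w x : Eu n} {ε : ℝ} :
    x ∈ plainHead S t w ε ↔ x - w ∈ plainCone S t ∧ ‖x - w‖ < ε := by
  rw [plainHead, mem_vadd_set_iff_neg_vadd_mem, vadd_eq_add, neg_add_eq_sub, mem_inter_iff,
    mem_ball_zero_iff]

/-- Heads of plain cones are included in each other as soon as heads of cones are. -/
theorem exists_pos_plainHead_subset {t : FaceType o} {w : Eu n} (h : Admissible S o t.sgn w)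
    {ε : ℝ} (hε : 0 < ε) : ∃ ρ > 0, ∀ (t' : FaceType o) (w' : Eu n), Admissible S o t'.sgn w' →
      ‖w' - w‖ < ρ → (∀ H, headSign o (w' - w) t'.sgn H = t.sgn H) →
      ∃ δ > 0, plainHead S t' w' δ ⊆ plainHead S t w ε := by
  have := W.finite_hyperplanes
  obtain ⟨ε', hε', hV⟩ := exists_pos_sub_mem_denseSpace (o := o) S t.sgn
  obtain ⟨ρ, hρε, hρε', hρ⟩ : ∃ ρ, ρ ≤ ε ∧ ρ ≤ ε' ∧ 0 < ρ :=
    ⟨min ε ε', min_le_left _ _, min_le_right _ _, lt_min hε hε'⟩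
  refine ⟨ρ, hρ, fun t' w' h' hd hs => ?_⟩
  obtain ⟨r, hr, hball⟩ := Metric.eventually_nhds_iff.1
    (eventually_all.2 fun H => sign_form_add_eventually (o := o) H (w' - w))
  have hcone : ∀ y ∈ coneSet o t'.sgn, ‖y‖ < r → w' - w + y ∈ coneSet o t.sgn := by
    intro y hy hyr H
    have h1 := hs H
    unfold headSign at h1
    split_ifs at h1 with h0
    · rw [map_add, h0, zero_add, hy H, h1]
    · rw [hball (by simpa using hyr) H h0, h1]
  refine ⟨min r (ρ - ‖w' - w‖), lt_min hr (by linarith), fun x hx => ?_⟩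
  rw [mem_plainHead] at hx ⊢
  obtain ⟨hxC, hxn⟩ := hx
  have hxr := hxn.trans_le (min_le_left _ _)
  have hxρ := hxn.trans_le (min_le_right _ _)
  have e : x - w = w' - w + (x - w') := by abel
  have hn : ‖x - w‖ < ρ := by
    rw [e]
    linarith [norm_add_le (w' - w) (x - w')]
  rw [plainCone_eq] at hxC ⊢
  refine ⟨⟨by rw [e]; exact hcone _ hxC.1 hxr, ?_⟩, hn.trans_le hρε⟩
  -- `x - w'` is approximated by `γ* - w'` within the cone of `t'`. Then `γ* - w` is in the cone of
  -- `t` and shorter than `ε'`, hence in the dense space of `t`, which is closed.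
  have hcl := Submodule.closed_of_finiteDimensional (denseSpace (spanGroup S (coneSet o t.sgn)))
  rw [← hcl.closure_eq, Metric.mem_closure_iff]
  intro η hη
  obtain ⟨γ₁, hγ₁⟩ := h'.exists_mem_plainCone
  rw [plainCone_eq] at hγ₁
  have hv : w' - S.star γ₁ ∈ denseSpace (spanGroup S (coneSet o t'.sgn)) := by
    rw [← neg_sub]
    exact Submodule.neg_mem _ hγ₁.2
  obtain ⟨γ, h1, h2⟩ := exists_star_sub_mem hv (S.star_mem γ₁) hxC.1 hxC.2
    (lt_min hη (lt_min (sub_pos.2 hxr) (sub_pos.2 hxρ)))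
  rw [sub_add_cancel] at h1 h2
  have hb := norm_add_le (S.star γ - w' - (x - w')) (x - w')
  rw [sub_add_cancel] at hb
  have h3 := h2.trans_le ((min_le_right _ _).trans (min_le_left _ _))
  have h4 := h2.trans_le ((min_le_right _ _).trans (min_le_right _ _))
  have e' : S.star γ - w = w' - w + (S.star γ - w') := by abel
  refine ⟨S.star γ - w, hV w h γ ?_ ?_, ?_⟩
  · rw [e']
    exact hcone _ h1 (by linarith)
  · rw [e']
    linarith [norm_add_le (w' - w) (S.star γ - w')]
  · rw [dist_comm, dist_eq_norm, sub_sub_sub_cancel_right]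
    rw [sub_sub_sub_cancel_right] at h2
    exact h2.trans_le (min_le_left _ _)

/-- The head contains a ray shrinking to its vertex `w'`. Its points have the signs of `t`, and near
the vertex these are the head signs. -/
theorem headSign_eq_of_plainHead_subset {t t' : FaceType o} {w w' : Eu n} {δ ε : ℝ} (hδ : 0 < δ)
    (hne : (plainCone S t').Nonempty) (h : plainHead S t' w' δ ⊆ plainHead S t w ε) :
    ‖w' - w‖ ≤ ε ∧ ∀ H, headSign o (w' - w) t'.sgn H = t.sgn H := by
  obtain ⟨x, hx⟩ := hne
  have hl := tendsto_smul_nhdsGT_zero x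
  have hev : ∀ᶠ c : ℝ in 𝓝[>] 0, w' - w + c • x ∈ coneSet o t.sgn ∧ ‖w' - w + c • x‖ < ε := by
    filter_upwards [hl.eventually (Metric.ball_mem_nhds 0 hδ), self_mem_nhdsWithin] with c hc hc0
    have h1 : w' + c • x ∈ plainHead S t' w' δ := by
      rw [mem_plainHead, add_sub_cancel_left]
      exact ⟨plainCone_smul_mem hx hc0, by simpa using hc⟩
    have h2 := mem_plainHead.1 (h h1)
    rw [add_sub_right_comm] at h2
    exact ⟨h2.1.1, h2.2⟩
  constructor
  · have hn : Tendsto (fun c : ℝ => ‖w' - w + c • x‖) (𝓝[>] 0) (𝓝 ‖w' - w‖) := by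
      simpa using (hl.const_add (w' - w)).norm
    exact le_of_tendsto hn (hev.mono fun c hc => hc.2.le)
  · intro H
    obtain ⟨c, ⟨h1, -⟩, h2, hc0⟩ := (hev.and ((hl.eventually
      (sign_form_add_eventually (o := o) H (w' - w))).and self_mem_nhdsWithin)).exists
    unfold headSign
    split_ifs with h0
    · rw [← h1 H, map_add, h0, zero_add, smul_mem_coneSet o hx.1 hc0 H]
    · rw [← h1 H, h2 h0]

end Cones

/-! ### The isomorphism and the convergence of cones -/

section Main

variable {n d : ℕ} {S : CutProject n d} {W : Window n} {o : W.Sides}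

/-- The vector and the cone type of an element of the Ellis semigroup. -/
noncomputable def ellisPair (hW : AlmostCanonical S W o) (g : Ellis S W) :
    Multiplicative (Eu n) × nontrivialFaces S o :=
  have h := admissible_ellis hW g
  let t : FaceType o := ⟨coneType S o g, let ⟨_, h1, _⟩ := h 1 one_pos; ⟨_, h1⟩⟩
  (Multiplicative.ofAdd (vec S W g), ⟨t, (admissible_iff (t := t).1 h).1⟩)

theorem range_ellisPair (hW : AlmostCanonical S W o) : range (ellisPair hW) = imageSet S o := by
  ext ⟨w, t⟩
  constructor
  · rintro ⟨g, hg⟩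
    rw [← hg]
    exact (admissible_iff.1 (admissible_ellis hW g)).2
  · intro h
    obtain ⟨g, h1, h2⟩ := exists_ellis hW (admissible_iff.2 ⟨t.2, h⟩)
    refine ⟨g, Prod.ext ?_ (Subtype.ext (FaceType.ext h2))⟩
    exact congrArg Multiplicative.ofAdd h1

theorem ellisPair_mul (hW : AlmostCanonical S W o) (g h : Ellis S W) :
    ellisPair hW (g * h) = ellisPair hW g * ellisPair hW h :=
  Prod.ext (congrArg Multiplicative.ofAdd (vec_mul g h))
    (Subtype.ext (FaceType.ext (coneType_mul hW g h)))

theorem ellisPair_injective (hW : AlmostCanonical S W o) :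
    Function.Injective (ellisPair hW) := by
  intro g h e
  refine ellis_ext hW (congrArg (fun p => p.1.toAdd) e) ?_
  exact congrArg (fun p : Multiplicative (Eu n) × nontrivialFaces S o => p.2.1.sgn) e

/-- The topology of the Ellis semigroup is given by the convergence of cones. -/
theorem ellis_tendsto_iff_coneConverges (hW : AlmostCanonical S W o) {ι : Type*} {l : Filter ι}
    {F : ι → Ellis S W} {g : Ellis S W} :
    Tendsto F l (𝓝 g) ↔
      ConeConverges S o l (fun i => ellisPair hW (F i)) (ellisPair hW g) := by
  rw [ellis_tendsto_iff hW]
  constructor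
  · rintro ⟨hv, hs⟩ ε hε
    obtain ⟨ρ, hρ, key⟩ := exists_pos_plainHead_subset (t := (ellisPair hW g).2.1)
      (admissible_ellis hW g) hε
    have hev : ∀ᶠ i in l, ∃ δ > 0,
        plainHead S (ellisPair hW (F i)).2.1 (ellisPair hW (F i)).1.toAdd δ ⊆
          plainHead S (ellisPair hW g).2.1 (ellisPair hW g).1.toAdd ε := by
      filter_upwards [Metric.tendsto_nhds.1 hv ρ hρ, hs] with i hi1 hi2
      exact key _ _ (admissible_ellis hW (F i)) (by rwa [← dist_eq_norm]) hi2
    classical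
    -- Positivity is required at every index; the value `1` is a default where no head fits.
    refine ⟨fun i => if h : ∃ δ > 0,
        plainHead S (ellisPair hW (F i)).2.1 (ellisPair hW (F i)).1.toAdd δ ⊆
          plainHead S (ellisPair hW g).2.1 (ellisPair hW g).1.toAdd ε then h.choose else 1, ?_, ?_⟩
    · intro i
      dsimp only
      split_ifs with h
      · exact h.choose_spec.1
      · exact one_pos
    · filter_upwards [hev] with i hi
      rw [dif_pos hi]
      exact hi.choose_spec.2
  · intro h
    have key : ∀ ε > 0, ∀ᶠ i in l, ‖vec S W (F i) - vec S W g‖ ≤ ε ∧ ∀ H,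
        headSign o (vec S W (F i) - vec S W g) (coneType S o (F i)) H = coneType S o g H := by
      intro ε hε
      obtain ⟨δ, hδ, hev⟩ := h ε hε
      filter_upwards [hev] with i hi
      exact headSign_eq_of_plainHead_subset (hδ i)
        (plainCone_nonempty (ellisPair hW (F i)).2.2) hi
    refine ⟨Metric.tendsto_nhds.2 fun ε hε => ?_, (key 1 one_pos).mono fun i hi => hi.2⟩
    filter_upwards [key (ε / 2) (half_pos hε)] with i hi
    rw [dist_eq_norm]
    linarith [hi.1]

end Main
end ModelSet

theorem mainTheorem2 {n d : ℕ} (S : CutProject n d) (W : Window n) (o : W.Sides)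
    (hW : AlmostCanonical S W o) :
    -- the maps `Λ ↦ w_Λ`, `g ↦ w_g` and `g ↦ t_g` are well defined
    (∀ (L : Internal S W) (w : Eu n), IsParam S W L w ↔ w = param S W L) ∧
    (∀ (g : Ellis S W) (v : Eu n),
      (∀ L, param S W (g.1 L) = param S W L + v) ↔ v = vec S W g) ∧
    (∀ (g : Ellis S W) (H : W.hyperplanes) (s : SignType),
      g ∈ ellisCut S W (side o H s (vec S W g)) ↔ s = coneType S o g H) ∧
    -- the isomorphism onto the subsemigroup
    (∃ T : Subsemigroup (Multiplicative (Eu n) × nontrivialFaces S o),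
      (T : Set (Multiplicative (Eu n) × nontrivialFaces S o)) = imageSet S o ∧
      ∃ φ : Ellis S W ≃* T,
        (∀ g, (φ g).1.1.toAdd = vec S W g ∧ (φ g).1.2.1.sgn = coneType S o g) ∧
        -- the homeomorphism for the convergence class
        ∃ τ : TopologicalSpace T,
          (∀ (ι : Type*) (l : Filter ι) (p : ι → T) (q : T),
            Tendsto p l (𝓝 q) ↔ ConeConverges S o l (fun i => (p i).1) q.1) ∧
          IsHomeomorph φ) ∧
    FirstCountableTopology (Ellis S W) := by
  refine ⟨isParam_iff, eq_vec_iff, mem_ellisCut_side_iff hW, ?_, firstCountable_ellis hW⟩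
  let T : Subsemigroup (Multiplicative (Eu n) × nontrivialFaces S o) :=
    { carrier := imageSet S o
      mul_mem' := by
        intro a b ha hb
        rw [← range_ellisPair hW] at ha hb ⊢
        obtain ⟨g, rfl⟩ := ha
        obtain ⟨h, rfl⟩ := hb
        exact ⟨g * h, ellisPair_mul hW g h⟩ }
  have hmem : ∀ g, ellisPair hW g ∈ T := fun g => by
    have : ellisPair hW g ∈ imageSet S o := range_ellisPair hW ▸ mem_range_self g
    exact this
  let f : Ellis S W →ₙ* T :=
    { toFun := fun g => ⟨ellisPair hW g, hmem g⟩
      map_mul' := fun g h => Subtype.ext (ellisPair_mul hW g h) }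
  have hf : Function.Bijective f := by
    constructor
    · intro g h e
      exact ellisPair_injective hW (congrArg Subtype.val e)
    · rintro ⟨p, hp⟩
      have hp' : p ∈ imageSet S o := hp
      rw [← range_ellisPair hW] at hp'
      obtain ⟨g, rfl⟩ := hp'
      exact ⟨g, rfl⟩
  let φ : Ellis S W ≃* T := MulEquiv.ofBijective f hf
  -- With the transported topology `φ` is a homeomorphism, so the convergence criterion on the Ellis
  -- semigroup carries over to the image.
  let τ : TopologicalSpace T := TopologicalSpace.coinduced φ inferInstance
  have hhomeo : IsHomeomorph φ :=
    (φ.toEquiv.toHomeomorph fun _ => isOpen_coinduced.symm).isHomeomorph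
  refine ⟨T, rfl, φ, fun g => ⟨rfl, rfl⟩, τ, fun ι l p q => ?_, hhomeo⟩
  obtain ⟨g, rfl⟩ := φ.surjective q
  obtain ⟨F, rfl⟩ : ∃ F : ι → Ellis S W, p = fun i => φ (F i) :=
    ⟨fun i => φ.symm (p i), funext fun i => (φ.apply_symm_apply _).symm⟩
  exact (hhomeo.isInducing.tendsto_nhds_iff (f := F) (y := g)).symm.trans
    (ellis_tendsto_iff_coneConverges hW)
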